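/- Let $T$ be a complete first-order theory with monster model $\mathfrak C$, and let $|T|$ be the maximum of $\aleph_0$ and the number of non-logical symbols of $T$. Let $\kappa_{\mathrm{ict}}(T)$ be the least infinite cardinal $\kappa$ (or $\infty$ if there is none) such that there are no $m<\omega$ and formulas $\langle\varphi_i(\bar x,\bar y_i):i<\kappa\rangle$ with $\ell g(\bar x)=m$ and all $\bar y_i$ finite for which, for some infinite cardinal $\lambda$ (equivalently, every infinite $\lambda$), the set $\{\varphi_i(\bar x_\eta,\bar y^i_\alpha)^{\text{if }(\eta(i)=\alpha)}:\eta\in{}^\kappa\lambda,\ \alpha<\lambda,\ i<\kappa\}$ is consistent with $T$. Here $\varphi^{\text{if }(\cdot)}$ is $\varphi$ if the condition in parentheses holds and $\neg\varphi$ otherwise. $T$ is called strongly dependent if $\kappa_{\mathrm{ict}}(T)=\aleph_0$. An equivalence relation on a linear order is convex if all its classes are convex. For an infinite ordinal $\alpha$ (or just an infinite index set for the tuples) consider the following conditions. * $(b)_\alpha$: for every infinite linear order $I$, every indiscernible sequence $\langle\bar a_t:t\in I\rangle$ with $\bar a_t\in{}^\alpha\mathfrak C$ and every finite $C\subseteq\mathfrak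 C$ there is a convex equivalence relation $E$ on $I$ with finitely many classes such that $s\,E\,t\Rightarrow \mathrm{tp}(\bar a_s,C)=\mathrm{tp}(\bar a_t,C)$. * $(c)_\alpha$: for all $I$, $\langle\bar a_t:t\in I\rangle$, $C$ as in $(b)_\alpha$ there is a convex equivalence relation $E$ on $I$ with finitely many classes such that for every $s\in I$ the sequence $\langle\bar a_t:t\in s/E\rangle$ is indiscernible over $C$. * $(b)'_\alpha$, $(c)'_\alpha$: the same as $(b)_\alpha$, $(c)_\alpha$, but only for sets $C$ that are singletons. (1), (2) For every infinite $\alpha$, each of $(b)_\alpha$, $(c)_\alpha$, $(b)'_\alpha$, $(c)'_\alpha$ is equivalent to $T$ being strongly dependent. (3) The same holds if in these four conditions $I$ is restricted to infinite well-orders. (4) Let $\kappa$ be an infinite cardinal and $\theta>|T|$ a cardinal with $\kappa=\kappa^{<\theta}$. Then the equivalences in (1), (2), (3) with $\alpha=\kappa$ remain true if the four conditions are restricted to sequences such that each $\bar a_t$ enumerates the universe of a $\theta$-saturated elementary submodel of $\mathfrak C$. They also remain true if the conditions are restricted further to sequences for which there is a family $\langle\bar a_u:u\in[I]^{<\aleph_0}\rangle$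 of tuples in $\mathfrak C$ (the length of $\bar a_u$ depending only on $|u|$) such that, with $A=\mathrm{Rang}(\bar a_\emptyset)$: (i) $\langle\bar a_u:u\in[I]^{<\aleph_0}\rangle$ is indiscernible over $A$, i.e. for all $n<\omega$ and $s_0<\dots<s_{n-1}$, $t_0<\dots<t_{n-1}$ in $I$ the concatenations of $\langle\bar a_{\{s_i:i\in w\}}:w\subseteq\{0,\dots,n-1\}\rangle$ and of $\langle\bar a_{\{t_i:i\in w\}}:w\subseteq\{0,\dots,n-1\}\rangle$ have the same type over $A$; (ii) $\bar a_{\{t\}}=\bar a_t$ for $t\in I$; (iii) each $\bar a_t$ enumerates the universe of a $\theta$-saturated elementary submodel of $\mathfrak C$; (iv) for some infinite linear orders $I_{-1},I_1$ there is a family $\langle\bar a'_u:u\in[I_{-1}+I+I_1]^{<\aleph_0}\rangle$, indiscernible over $A$, with $\bar a'_u=\bar a_u$ for $u\in[I]^{<\aleph_0}$, such that for every $B\subseteq A$ with $|B|<\theta$, every subset of cardinality $<\theta$ of the type of $\langle\bar a'_u:u\in[I_{-1}+I_1]^{<\aleph_0}\rangle$ over $B\cup\bigcup\{\mathrm{Rang}(\bar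 a_u):u\in[I]^{<\aleph_0}\}$ is realized by elements of $A$. -/

import Mathlib

open FirstOrder Cardinal

universe u

namespace StrongDep

variable {L : FirstOrder.Language.{u, u}}

/-! ### Strong dependence -/

/-- The set of formulas `Γ_Λ = {φ_i(x_η, y^i_α)^{if (η(i) = α)} : η ∈ ^ι Λ, α ∈ Λ, i ∈ ι}` is
consistent with `T`: some model of `T` contains tuples `c η` (interpreting `x_η`) and `b i α`
(interpreting `y^i_α`) such that `φ_i(c η, b i α)` holds exactly when `η i = α`. -/
def GammaConsistent (T : L.Theory) {ι : Type u} {m : ℕ} {n : ι → ℕ}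
    (φ : (i : ι) → L.Formula (Fin m ⊕ Fin (n i))) (Λ : Type u) : Prop :=
  ∃ (M : FirstOrder.Language.Theory.ModelType.{u, u, u} T)
    (c : (ι → Λ) → Fin m → M) (b : (i : ι) → Λ → Fin (n i) → M),
    ∀ (η : ι → Λ) (i : ι) (α : Λ), (φ i).Realize (Sum.elim (c η) (b i α)) ↔ η i = α

/-- Some sequence `⟨φ_i(x, y_i) : i < κ⟩` of formulas (with `x` a fixed finite tuple and the `y_i`
finite tuples) witnesses `κ < κ_ict(T)`, i.e. `Γ_Λ` is consistent with `T` for some infinite `Λ`. -/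
def HasIctWitness (T : L.Theory) (κ : Cardinal.{u}) : Prop :=
  ∃ (ι : Type u) (m : ℕ) (n : ι → ℕ) (φ : (i : ι) → L.Formula (Fin m ⊕ Fin (n i))),
    #ι = κ ∧ ∃ Λ : Type u, Infinite Λ ∧ GammaConsistent T φ Λ

/-- `κ_ict(T)`: the least infinite cardinal `κ` without a witness, and `⊤` (that is, `∞`) if there
is none. -/
noncomputable def kappaIct (T : L.Theory) : WithTop Cardinal.{u} :=
  sInf ((fun κ : Cardinal.{u} => (κ : WithTop Cardinal.{u})) ''
    {κ | ℵ₀ ≤ κ ∧ ¬ HasIctWitness T κ})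

/-- `T` is strongly dependent: `κ_ict(T) = ℵ₀`. -/
def StronglyDependent (T : L.Theory) : Prop :=
  kappaIct T = ((ℵ₀ : Cardinal.{u}) : WithTop Cardinal.{u})

/-! ### Types, indiscernible sequences, saturation -/

section Basic

variable {M : Type u} [L.Structure M]

variable (L) in
/-- The complete type `tp(v, C)` in `M` of a tuple `v = ⟨v_x : x ∈ β⟩` over `C ⊆ M`; the variables
from `C` stand for the parameters. -/
def tp (C : Set M) {β : Type u} (v : β → M) : Set (L.Formula (C ⊕ β)) :=
  {φ | φ.Realize (Sum.elim (fun c : C => (c : M)) v)}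

variable (L) in
/-- `⟨a_t : t ∈ I⟩`, a sequence of tuples indexed by `α`, is an indiscernible sequence over `C`:
for `s_0 < ⋯ < s_{n-1}` and `t_0 < ⋯ < t_{n-1}` the concatenations `a_{s_0} ⋯ a_{s_{n-1}}` and
`a_{t_0} ⋯ a_{t_{n-1}}` have the same type over `C`. -/
def IndiscernibleOver (C : Set M) {I : Type u} [LinearOrder I] {α : Type u}
    (a : I → α → M) : Prop :=
  ∀ (n : ℕ) (s t : Fin n ↪o I),
    tp L C (fun x : Fin n × α => a (s x.1) x.2) = tp L C (fun x : Fin n × α => a (t x.1) x.2)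

variable (L) in
/-- `N` is `θ`-saturated: every finitely satisfiable set of formulas in one variable over a
parameter set of cardinality `< θ` is realized in `N`. -/
def IsSaturated (θ : Cardinal.{u}) (N : Type u) [L.Structure N] : Prop :=
  ∀ A : Set N, #A < θ → ∀ p : Set (L.Formula (A ⊕ Unit)),
    (∀ q ⊆ p, q.Finite → ∃ x : N, ∀ φ ∈ q,
      φ.Realize (Sum.elim (fun c : A => (c : N)) (fun _ => x))) →
    ∃ x : N, ∀ φ ∈ p, φ.Realize (Sum.elim (fun c : A => (c : N)) (fun _ => x))

variable (L) in
/-- The tuple `v` enumerates (possibly with repetitions) the universe of a `θ`-saturated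
elementary submodel of `M`. -/
def EnumeratesSaturated (θ : Cardinal.{u}) {α : Type u} (v : α → M) : Prop :=
  ∃ N : L.ElementarySubstructure M, Set.range v = (N : Set M) ∧ IsSaturated L θ N

/-! ### Families indexed by the finite subsets of a linear order -/

/-- A family `⟨b_u : u ∈ [I]^{<ℵ₀}⟩` of tuples in `M`. The `k`-element subset `u` is given by its
increasing enumeration `Fin k ↪o I`; the tuple `b_u` is indexed by `ℓ k`, so that its length
depends only on the size of `u`. -/
abbrev Family (I : Type u) [LinearOrder I] (ℓ : ℕ → Type u) (M : Type u) : Type u :=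
  (k : ℕ) → (Fin k ↪o I) → ℓ k → M

variable (L) in
/-- `⟨b_u : u ∈ [I]^{<ℵ₀}⟩` is indiscernible over `A`: for `s_0 < ⋯ < s_{n-1}` and
`t_0 < ⋯ < t_{n-1}`, the concatenations of the `b_{{s_i : i ∈ w}}` and of the `b_{{t_i : i ∈ w}}`,
where `w` runs over the subsets of `{0, …, n-1}`, have the same type over `A`. -/
def FamilyIndiscernibleOver (A : Set M) {I : Type u} [LinearOrder I] {ℓ : ℕ → Type u}
    (b : Family I ℓ M) : Prop :=
  ∀ (n : ℕ) (s t : Fin n ↪o I),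
    tp L A (fun x : (Σ k : ℕ, (Fin k ↪o Fin n) × ℓ k) => b x.1 (x.2.1.trans s) x.2.2) =
    tp L A (fun x : (Σ k : ℕ, (Fin k ↪o Fin n) × ℓ k) => b x.1 (x.2.1.trans t) x.2.2)

/-- `Rang(b_∅)`. -/
def Family.base {I : Type u} [LinearOrder I] {ℓ : ℕ → Type u} (b : Family I ℓ M) : Set M :=
  {x | ∃ (ρ : Fin 0 ↪o I) (i : ℓ 0), b 0 ρ i = x}

/-- The set of all entries of the `b_u`, `u ∈ [I]^{<ℵ₀}`. -/
def Family.entries {I : Type u} [LinearOrder I] {ℓ : ℕ → Type u} (b : Family I ℓ M) : Set M :=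
  {x | ∃ (k : ℕ) (ρ : Fin k ↪o I) (i : ℓ k), b k ρ i = x}

/-- The embedding of `I` into the ordered sum `I₋ + I + I₊`. -/
def midEmb (Im I Ip : Type u) [LinearOrder Im] [LinearOrder I] [LinearOrder Ip] :
    I ↪o (Im ⊕ₗ (I ⊕ₗ Ip)) :=
  OrderEmbedding.ofMapLEIff (fun t => Sum.inrₗ (Sum.inlₗ t)) (by simp)

variable (L) in
/-- The sequence `⟨a_t : t ∈ I⟩` is part of a family `⟨b_u : u ∈ [I]^{<ℵ₀}⟩` such that, with
`A = Rang(b_∅)`: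
* the family is indiscernible over `A`, and `b_{{t}} = a_t` (up to a renaming `r` of indices);
* each `a_t` enumerates the universe of a `θ`-saturated elementary submodel;
* for some infinite linear orders `I₋`, `I₊` there is a family
  `⟨b'_u : u ∈ [I₋ + I + I₊]^{<ℵ₀}⟩`, indiscernible over `A`, with `b'_u = b_u` for
  `u ∈ [I]^{<ℵ₀}`, such that for every `B ⊆ A` of cardinality `< θ`, every subset `q` of
  cardinality `< θ` of the type of `⟨b'_u : u ∈ [I₋ + I₊]^{<ℵ₀}⟩` over
  `B ∪ ⋃ {Rang(b_u) : u ∈ [I]^{<ℵ₀}}` is realized in `A`. -/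
def InSaturatedFamily (θ : Cardinal.{u}) {I : Type u} [LinearOrder I] {α : Type u}
    (a : I → α → M) : Prop :=
  ∃ (ℓ : ℕ → Type u) (b : Family I ℓ M),
    FamilyIndiscernibleOver L b.base b ∧
    (∃ r : ℓ 1 ≃ α, ∀ (ρ : Fin 1 ↪o I) (x : ℓ 1), b 1 ρ x = a (ρ 0) (r x)) ∧
    (∀ t : I, EnumeratesSaturated L θ (a t)) ∧
    ∃ (Im Ip : Type u) (_ : LinearOrder Im) (_ : LinearOrder Ip) (_ : Infinite Im)
      (_ : Infinite Ip) (b' : Family (Im ⊕ₗ (I ⊕ₗ Ip)) ℓ M),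
      FamilyIndiscernibleOver L b.base b' ∧
      (∀ (k : ℕ) (ρ : Fin k ↪o I), b' k (ρ.trans (midEmb Im I Ip)) = b k ρ) ∧
      ∀ B ⊆ b.base, #B < θ →
        ∀ q ⊆ tp L (B ∪ b.entries)
            (fun x : (Σ k : ℕ, {ρ : Fin k ↪o (Im ⊕ₗ (I ⊕ₗ Ip)) //
                ∀ i, ρ i ∉ Set.range (midEmb Im I Ip)} × ℓ k) =>
              b' x.1 x.2.1.1 x.2.2),
          #q < θ →
          ∃ v : (Σ k : ℕ, {ρ : Fin k ↪o (Im ⊕ₗ (I ⊕ₗ Ip)) //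
                ∀ i, ρ i ∉ Set.range (midEmb Im I Ip)} × ℓ k) → M,
            (∀ x, v x ∈ b.base) ∧ q ⊆ tp L (B ∪ b.entries) v

end Basic

/-! ### The cutting conditions -/

/-- A restriction on the sequences `⟨a_t : t ∈ I⟩` of `α`-tuples to be considered. -/
abbrev SeqClass (L : FirstOrder.Language.{u, u}) (α : Type u) : Type (u + 1) :=
  (M : Type u) → [L.Structure M] → (I : Type u) → [LinearOrder I] → (I → α → M) → Prop

/-- No restriction. -/
def anySeq (L : FirstOrder.Language.{u, u}) (α : Type u) : SeqClass L α :=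
  fun _ _ _ _ _ => True

/-- Each `a_t` enumerates the universe of a `θ`-saturated model. -/
def satSeq (L : FirstOrder.Language.{u, u}) (α : Type u) (θ : Cardinal.{u}) : SeqClass L α :=
  fun _ _ _ _ a => ∀ t, EnumeratesSaturated L θ (a t)

/-- The sequence is part of a family as in `InSaturatedFamily`. -/
def satFamilySeq (L : FirstOrder.Language.{u, u}) (α : Type u) (θ : Cardinal.{u}) :
    SeqClass L α :=
  fun _ _ _ _ a => InSaturatedFamily L θ a

/-- The sequences of the class `P` with a well-ordered index set. -/
def SeqClass.wellOrdered {α : Type u} (P : SeqClass L α) : SeqClass L α :=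
  fun M _ I _ a => WellFoundedLT I ∧ P M I a

/-- A restriction on the parameter sets `C`. -/
abbrev SetClass : Type (u + 1) := (M : Type u) → Set M → Prop

/-- `C` is finite. -/
def finiteSets : SetClass.{u} := fun _ C => C.Finite

/-- `C` is a singleton. -/
def singletons : SetClass.{u} := fun _ C => ∃ c, C = {c}

/-- `E` is a convex equivalence relation with finitely many classes. -/
def IsFiniteConvex {I : Type u} [LinearOrder I] (E : Setoid I) : Prop :=
  (∀ s, {t | E.r s t}.OrdConnected) ∧ Finite (Quotient E)

/-- Condition (b): for every infinite linear order `I`, every indiscernible sequence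
`⟨a_t : t ∈ I⟩` of `α`-tuples in a model of `T` (in the class `P`) and every `C` (in the class `Q`)
there is a convex equivalence relation `E` on `I` with finitely many classes such that
`s E t` implies `tp(a_s, C) = tp(a_t, C)`. -/
def CutTypes (T : L.Theory) (α : Type u) (P : SeqClass L α) (Q : SetClass.{u}) : Prop :=
  ∀ (M : FirstOrder.Language.Theory.ModelType.{u, u, u} T) (I : Type u) [LinearOrder I]
    [Infinite I] (a : I → α → M), IndiscernibleOver L (∅ : Set M) a → P M I a →
    ∀ C : Set M, Q M C →
      ∃ E : Setoid I, IsFiniteConvex E ∧ ∀ s t, E.r s t → tp L C (a s) = tp L C (a t)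

/-- Condition (c): as in (b), but now for each `s ∈ I` the sequence `⟨a_t : t ∈ s/E⟩` is
indiscernible over `C`. -/
def CutIndiscernible (T : L.Theory) (α : Type u) (P : SeqClass L α) (Q : SetClass.{u}) : Prop :=
  ∀ (M : FirstOrder.Language.Theory.ModelType.{u, u, u} T) (I : Type u) [LinearOrder I]
    [Infinite I] (a : I → α → M), IndiscernibleOver L (∅ : Set M) a → P M I a →
    ∀ C : Set M, Q M C →
      ∃ E : Setoid I, IsFiniteConvex E ∧
        ∀ s, IndiscernibleOver L C (fun t : {t : I // E.r s t} => a t.1)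

end StrongDep

namespace StrongDep

variable {L : FirstOrder.Language.{u, u}}

/-! ### Formulas with finitely many free variables -/

section Formulas

variable {M : Type u} [L.Structure M]

/-! Strong dependence fails exactly when some countable family of formulas forms a pattern, so
everything is a matter of producing or excluding `IctPattern`.

A pattern refutes the weakest condition. All the parameter tuples of one column are concatenated
into a single tuple; Ramsey's theorem and compactness (`exists_indiscernible_pattern`) turn the
columns into an indiscernible sequence `a` over any linear order, keeping tuples `c η` such that `ψ
i` holds of `c η` and `a t` exactly when `η i = t`. If `η` is a bijection onto `ω`, the `a t` have
pairwise different types over `c η`, and no equivalence relation with finitely many classes can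
respect these types. For sequences of saturated models, each `a t` is enlarged to realize the type
of an enumeration of a `θ`-saturated model (`HasPattern.extend`, `exists_saturated_model`), and the
sequence is taken along `J + (ω + I + ω*) + J*` with `J` of order type `θ⁺`. The outer tuples form
the base `A`. Fewer than `θ` formulas see only a bounded part of `J`, so `ω` and `ω*` can be pushed
into `J` and `J*` beyond that part (`inSaturatedFamily_of_indiscernible`).

Conversely, assume that there is no pattern in one variable and let `c` be an element. If the index
set cannot be cut into finitely many convex pieces on which `a` is indiscernible over `c`, there are
infinitely many sets `D r`, pairwise separated in the order, on each of which indiscernibility over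
`c` fails (`exists_separated_family`). Each failure comes from moving a single point of an
increasing tuple, which changes the truth value of some `φ r`. Indiscernibility over `∅` allows
these changes to be placed independently at a prescribed position for every `r`
(`exists_finite_configuration`), so the formulas "`φ r` changes here" form a pattern, a
contradiction. Finite sets are treated one element at a time, the earlier elements being appended to
the `a t`. Thus the absence of one-variable patterns gives the strongest condition, whose failure
follows from a pattern in any number of variables; this is why singletons suffice. -/

theorem realize_congr_of_freeVar {Y : Type*} [DecidableEq Y] (φ : L.Formula Y) {v w : Y → M}
    (h : ∀ y ∈ φ.freeVarFinset, v y = w y) : φ.Realize v ↔ φ.Realize w := by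
  have h1 := Language.BoundedFormula.realize_restrictFreeVar (φ := φ)
    (f := fun y : φ.freeVarFinset => y) (v := fun y => v y) (xs := default) v (fun _ => rfl)
  have h2 := Language.BoundedFormula.realize_restrictFreeVar (φ := φ)
    (f := fun y : φ.freeVarFinset => y) (v := fun y => w y) (xs := default) w (fun _ => rfl)
  have h3 : (fun y : φ.freeVarFinset => v y) = fun y : φ.freeVarFinset => w y :=
    funext fun y => h y y.2
  rw [h3] at h1
  exact h1.symm.trans h2

open Classical in
/-- Existential quantification over an arbitrary set of variables. -/
theorem exists_formula_ex {A Y : Type*} (φ : L.Formula (A ⊕ Y)) :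
    ∃ ψ : L.Formula A, ∀ (M : Type u) [L.Structure M] [Nonempty M] (v : A → M),
      ψ.Realize v ↔ ∃ w : Y → M, φ.Realize (Sum.elim v w) := by
  -- Only finitely many variables occur, so a finite block of quantifiers suffices. It is indexed by
  -- all free variables of `φ`; the copies of those from `A` are dummies.
  let g : φ.freeVarFinset → A ⊕ φ.freeVarFinset := fun z =>
    match z with
    | ⟨Sum.inl a, _⟩ => Sum.inl a
    | ⟨Sum.inr y, h⟩ => Sum.inr ⟨Sum.inr y, h⟩
  refine ⟨Language.Formula.iExs φ.freeVarFinset (φ.restrictFreeVar g), fun M _ _ v => ?_⟩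
  rw [Language.Formula.realize_iExs]
  constructor
  · rintro ⟨i, hi⟩
    let w : Y → M := fun y => if h : Sum.inr y ∈ φ.freeVarFinset then i ⟨_, h⟩ else
      Classical.arbitrary M
    let e : φ.freeVarFinset → M := fun z => Sum.elim v w z
    refine ⟨w, ?_⟩
    refine (Language.BoundedFormula.realize_restrictFreeVar (f := g) (Sum.elim v w) ?_).1 hi
    rintro ⟨a | y, h⟩
    · rfl
    · simp [g, w, h]
  · rintro ⟨w, hw⟩
    refine ⟨fun z => Sum.elim v w z, ?_⟩
    refine (Language.BoundedFormula.realize_restrictFreeVar (f := g) (Sum.elim v w) ?_).2 hw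
    rintro ⟨a | y, h⟩ <;> rfl

/-- Conjunction of a finite set of formulas. -/
theorem exists_formula_conj {Y : Type*} {s : Set (L.Formula Y)} (hs : s.Finite) :
    ∃ ψ : L.Formula Y, ∀ (M : Type u) [L.Structure M] (v : Y → M),
      ψ.Realize v ↔ ∀ φ ∈ s, φ.Realize v := by
  have := hs.to_subtype
  exact ⟨Language.Formula.iInf (fun φ : s => (φ : L.Formula Y)), fun M _ v => by
    simp [Language.Formula.realize_iInf]⟩

theorem realize_sum_relabel {X Y Z : Type*} (φ : L.Formula (X ⊕ Y)) (g : Y → Z) (v : X → M)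
    (w : Z → M) : (φ.relabel (Sum.map id g)).Realize (Sum.elim v w) ↔
      φ.Realize (Sum.elim v (fun y => w (g y))) := by
  rw [Language.Formula.realize_relabel]
  refine iff_of_eq (congrArg _ ?_)
  funext x; cases x <;> rfl

end Formulas

/-! ### Compactness for sets of formulas -/

/-- The set `Q` of formulas is satisfied by some tuple in some model of `T`. -/
def Sat (T : L.Theory) {V : Type u} (Q : Set (L.Formula V)) : Prop :=
  ∃ (M : FirstOrder.Language.Theory.ModelType.{u, u, u} T) (v : V → M), ∀ φ ∈ Q, φ.Realize v

theorem Sat.mono {T : L.Theory} {V : Type u} {Q Q' : Set (L.Formula V)} (h : Sat T Q')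
    (hQ : Q ⊆ Q') : Sat T Q := by
  obtain ⟨M, v, hv⟩ := h
  exact ⟨M, v, fun φ hφ => hv φ (hQ hφ)⟩

/-- Compactness by an ultraproduct over the finite subsets of `Q`: an ultrafilter refining `atTop`
contains, for each `φ ∈ Q`, the cone of finite sets containing `φ`. -/
theorem sat_of_finite {T : L.Theory} {V : Type u} {Q : Set (L.Formula V)}
    (h : ∀ q ⊆ Q, q.Finite → Sat T q) : Sat T Q := by
  classical
  have h' : ∀ q : Finset Q, Sat T {φ | ∃ x ∈ q, φ = x.1} := fun q =>
    h _ (by rintro _ ⟨x, -, rfl⟩; exact x.2)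
      ((q.finite_toSet.image Subtype.val).subset (by rintro _ ⟨x, hx, rfl⟩; exact ⟨x, hx, rfl⟩))
  choose M v hv using h'
  let U : Ultrafilter (Finset Q) := Ultrafilter.of Filter.atTop
  have hT : (U : Filter (Finset Q)).Product (fun q => (M q : Type u)) ⊨ T := by
    refine ⟨fun φ hφ => ?_⟩
    rw [Language.Ultraproduct.sentence_realize]
    exact Filter.Eventually.of_forall fun q => Language.Theory.realize_sentence_of_mem T hφ
  refine ⟨Language.Theory.ModelType.of T ((U : Filter (Finset Q)).Product
    (fun q => (M q : Type u))), fun x => ((fun q => v q x : ∀ q, M q) :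
      (U : Filter (Finset Q)).Product (fun q => (M q : Type u))), fun φ hφ => ?_⟩
  refine (Language.Ultraproduct.realize_formula_cast (u := U) (M := fun q => (M q : Type u)) φ
    (fun x q => v q x)).2 ?_
  refine Filter.Eventually.filter_mono (Ultrafilter.of_le _) (Filter.eventually_atTop.2
    ⟨{⟨φ, hφ⟩}, fun q hq => hv q φ ⟨⟨φ, hφ⟩, hq (Finset.mem_singleton_self _), rfl⟩⟩)

theorem sat_range_of_finset {T : L.Theory} {V J : Type u} {F : J → L.Formula V}
    (h : ∀ s : Finset J, Sat T {φ | ∃ x ∈ s, F x = φ}) : Sat T (Set.range F) := by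
  classical
  refine sat_of_finite fun q hq hfin => ?_
  obtain ⟨q, rfl⟩ := hfin.exists_finset_coe
  rw [← Set.image_univ, Finset.subset_set_image_iff] at hq
  obtain ⟨s, -, rfl⟩ := hq
  exact (h s).mono (by intro φ hφ; simpa using hφ)

/-! ### Moving the points of an indiscernible sequence -/

section Moving

variable {M : Type u} [L.Structure M]

theorem indiscernibleOver_empty_realize {I α : Type u} [LinearOrder I] {a : I → α → M}
    (ha : IndiscernibleOver L (∅ : Set M) a) {n : ℕ} (s t : Fin n ↪o I)
    (φ : L.Formula (Fin n × α)) :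
    φ.Realize (fun x => a (s x.1) x.2) ↔ φ.Realize (fun x => a (t x.1) x.2) := by
  have h := ha n s t
  have key : ∀ w : (Fin n × α) → M, φ.relabel Sum.inr ∈ tp L (∅ : Set M) w ↔ φ.Realize w := by
    intro w
    change (Language.Formula.relabel _ _).Realize _ ↔ _
    rw [Language.Formula.realize_relabel, Sum.elim_comp_inr]
  rw [← key, h, key]

/-- In an indiscernible sequence, formulas are preserved when the index points are replaced by
points in the same order configuration. -/
theorem realize_move {I α : Type u} {Y : Type*} [DecidableEq Y] [LinearOrder I]
    {a : I → α → M} (ha : IndiscernibleOver L (∅ : Set M) a) (φ : L.Formula Y) (f g : Y → I) (x : Y → α)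
    (h : ∀ y ∈ φ.freeVarFinset, ∀ z ∈ φ.freeVarFinset, f y < f z ↔ g y < g z) :
    φ.Realize (fun y => a (f y) (x y)) ↔ φ.Realize (fun y => a (g y) (x y)) := by
  set F := φ.freeVarFinset with hF
  have heq : ∀ y ∈ F, ∀ z ∈ F, f y = f z → g y = g z := by
    intro y hy z hz hyz
    refine le_antisymm (not_lt.1 fun hlt => ?_) (not_lt.1 fun hlt => ?_)
    · exact absurd ((h z hz y hy).2 hlt) (by simp [hyz])
    · exact absurd ((h y hy z hz).2 hlt) (by simp [hyz])
  -- The finitely many points `f y` are enumerated increasingly by `s`; the corresponding points `g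
  -- y` form the increasing tuple `t`, and indiscernibility compares `s` with `t`.
  let s : Fin (F.image f).card ↪o I := (F.image f).orderEmbOfFin rfl
  have hs : ∀ k, ∃ y ∈ F, f y = s k := fun k => by
    exact Finset.mem_image.1 ((F.image f).orderEmbOfFin_mem rfl k)
  choose r hrF hr using hs
  let t : Fin (F.image f).card ↪o I := OrderEmbedding.ofStrictMono (fun k => g (r k)) (by
    intro k l hkl
    exact (h _ (hrF k) _ (hrF l)).1 (by rw [hr, hr]; exact s.strictMono hkl))
  have hidx : ∀ y ∈ F, ∃ k, s k = f y := by
    intro y hy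
    have : f y ∈ Set.range s := by
      rw [Finset.range_orderEmbOfFin]; exact Finset.mem_image_of_mem f hy
    exact this
  -- Without free variables the index type may be empty, leaving no default value for `k`.
  rcases F.eq_empty_or_nonempty with hE | ⟨y0, hy0⟩
  · exact realize_congr_of_freeVar φ (fun y hy => by rw [← hF, hE] at hy; simp at hy)
  obtain ⟨k0, -⟩ := hidx y0 hy0
  let k : Y → Fin (F.image f).card := fun y => if hy : y ∈ F then (hidx y hy).choose else k0
  have hk : ∀ y ∈ F, s (k y) = f y := fun y hy => by
    simp only [k, dif_pos hy]; exact (hidx y hy).choose_spec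
  have hkt : ∀ y ∈ F, t (k y) = g y := fun y hy =>
    heq _ (hrF _) _ hy (by rw [hr, hk y hy])
  have h1 := indiscernibleOver_empty_realize ha s t (φ.relabel (fun y => (k y, x y)))
  rw [Language.Formula.realize_relabel, Language.Formula.realize_relabel] at h1
  refine Iff.trans ?_ (h1.trans ?_)
  · exact realize_congr_of_freeVar φ (fun y hy => by simp [hk y hy])
  · exact realize_congr_of_freeVar φ (fun y hy => by simp [hkt y hy])

/-- Every finite set of formulas satisfied by some element over points of an indiscernible
sequence is satisfied by some element over points in the same order configuration. -/
theorem exists_move {I α : Type u} {Y X : Type*} [LinearOrder I] [Nonempty M] {a : I → α → M}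
    (ha : IndiscernibleOver L (∅ : Set M) a) (f g : Y → I) (x : Y → α)
    (h : ∀ y z, f y < f z ↔ g y < g z) {Δ : Set (L.Formula (X ⊕ Y))} (hΔ : Δ.Finite)
    (c : X → M) :
    ∃ d : X → M, ∀ φ ∈ Δ, φ.Realize (Sum.elim d (fun y => a (g y) (x y))) ↔
      φ.Realize (Sum.elim c (fun y => a (f y) (x y))) := by
  classical
  -- Each formula is replaced by itself or its negation, whichever is true. The existence of a tuple
  -- satisfying all of these is a single formula about the sequence, to which `realize_move`
  -- applies.
  let sgn : L.Formula (X ⊕ Y) → L.Formula (X ⊕ Y) := fun φ =>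
    if φ.Realize (Sum.elim c (fun y => a (f y) (x y))) then φ else φ.not
  have hsgn : ∀ φ ∈ Δ, (sgn φ).Realize (Sum.elim c (fun y => a (f y) (x y))) := by
    intro φ _
    by_cases hφ : φ.Realize (Sum.elim c (fun y => a (f y) (x y)))
    · simp [sgn, hφ]
    · simp [sgn, hφ, Language.Formula.realize_not]
  obtain ⟨χ, hχ⟩ := exists_formula_conj ((hΔ.image sgn).image
    (fun φ => φ.relabel (Sum.swap : X ⊕ Y → Y ⊕ X)))
  have hχ' : ∀ (v : Y → M) (w : X → M), χ.Realize (Sum.elim v w) ↔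
      ∀ φ ∈ Δ, (sgn φ).Realize (Sum.elim w v) := by
    intro v w
    rw [hχ]
    simp only [Set.forall_mem_image, Language.Formula.realize_relabel]
    refine forall₂_congr fun φ _ => iff_of_eq (congrArg _ ?_)
    funext z; cases z <;> rfl
  obtain ⟨ψ, hψ⟩ := exists_formula_ex χ
  have h1 : ψ.Realize (fun y => a (f y) (x y)) := (hψ M _).2 ⟨c, (hχ' _ _).2 hsgn⟩
  have h2 := (realize_move ha ψ f g x (fun y _ z _ => h y z)).1 h1
  obtain ⟨d, hd⟩ := (hψ M _).1 h2
  refine ⟨d, fun φ hφ => ?_⟩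
  have := (hχ' _ _).1 hd φ hφ
  by_cases hc : φ.Realize (Sum.elim c (fun y => a (f y) (x y)))
  · simpa [sgn, hc] using this
  · simpa [sgn, hc, Language.Formula.realize_not] using this

end Moving

/-! ### Finite Ramsey theorem and extraction of indiscernible sequences -/

/-- Iterated quantification along a nonprincipal ultrafilter on `ℕ`. -/
def ultraTruth (f : Finset ℕ → Prop) : ℕ → Finset ℕ → Prop
  | 0, S => f S
  | j + 1, S => ∀ᶠ t in (Filter.hyperfilter ℕ : Filter ℕ), ultraTruth f j (insert t S)

theorem eventually_ultraTruth (f : Finset ℕ → Prop) (j : ℕ) (S : Finset ℕ) :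
    ∀ᶠ t in (Filter.hyperfilter ℕ : Filter ℕ),
      (ultraTruth f j (insert t S) ↔ ultraTruth f (j + 1) S) := by
  by_cases h : ultraTruth f (j + 1) S
  · have h' : ∀ᶠ t in (Filter.hyperfilter ℕ : Filter ℕ), ultraTruth f j (insert t S) := h
    filter_upwards [h'] with t ht
    simp [ht, h]
  · have h' : ∀ᶠ t in (Filter.hyperfilter ℕ : Filter ℕ), ¬ ultraTruth f j (insert t S) :=
      Ultrafilter.eventually_not.2 h
    filter_upwards [h'] with t ht
    simp [ht, h]

/-- `H` grows one point at a time. Almost every `t` decides all the finitely many statements about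
subsets of the current `H` in the way the ultrafilter does, so such a `t` preserves the invariant.
For `S.card = d.1` no quantifier is left and the invariant is homogeneity. -/
theorem exists_finset_homogeneous (D : Finset (ℕ × (Finset ℕ → Prop))) (N : ℕ) :
    ∃ H : Finset ℕ, H.card = N ∧ ∀ d ∈ D, ∀ S ⊆ H, S.card ≤ d.1 →
      (ultraTruth d.2 (d.1 - S.card) S ↔ ultraTruth d.2 d.1 ∅) := by
  induction N with
  | zero =>
    refine ⟨∅, rfl, fun d _ S hS _ => ?_⟩
    rw [Finset.subset_empty.1 hS]; simp
  | succ N ih =>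
    obtain ⟨H, hN, hH⟩ := ih
    have h1 : ∀ᶠ t in (Filter.hyperfilter ℕ : Filter ℕ), t ∉ H := by
      refine Filter.hyperfilter_le_cofinite ?_
      have : {x | x ∉ H}ᶜ = (H : Set ℕ) := by ext; simp
      exact Filter.mem_cofinite.2 (this ▸ H.finite_toSet)
    -- The subtraction is truncated, but the clause is used only for `S.card < d.1`.
    have h2 : ∀ᶠ t in (Filter.hyperfilter ℕ : Filter ℕ), ∀ d ∈ D, ∀ S ∈ H.powerset,
        (ultraTruth d.2 (d.1 - S.card - 1) (insert t S) ↔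
          ultraTruth d.2 (d.1 - S.card - 1 + 1) S) := by
      rw [Filter.eventually_all_finset]
      intro d _
      rw [Filter.eventually_all_finset]
      intro S _
      exact eventually_ultraTruth _ _ _
    obtain ⟨t, ht, hD⟩ := (h1.and h2).exists
    refine ⟨insert t H, by rw [Finset.card_insert_of_notMem ht, hN], fun d hd S hS hc => ?_⟩
    by_cases htS : t ∈ S
    · have hS' : S.erase t ⊆ H := by
        intro x hx
        have := hS (Finset.mem_of_mem_erase hx)
        exact (Finset.mem_insert.1 this).resolve_left (Finset.ne_of_mem_erase hx)
      have hcard := Finset.card_erase_add_one htS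
      have e1 := hD d hd (S.erase t) (Finset.mem_powerset.2 hS')
      rw [Finset.insert_erase htS, show d.1 - (S.erase t).card - 1 = d.1 - S.card by omega,
        show d.1 - S.card + 1 = d.1 - (S.erase t).card by omega] at e1
      exact e1.trans (hH d hd _ hS' (by omega))
    · refine hH d hd S (fun x hx => (Finset.mem_insert.1 (hS hx)).resolve_left ?_) hc
      rintro rfl; exact htS hx

/-- A finite form of Ramsey's theorem. -/
theorem exists_strictMonoOn_homogeneous {K : Type u} [LinearOrder K] (F : Finset K)
    (D : Finset (Σ n : ℕ, (Fin n → ℕ) → Prop)) :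
    ∃ h : K → ℕ, StrictMonoOn h F ∧ ∀ d ∈ D, ∀ s t : Fin d.1 → K, StrictMono s → StrictMono t →
      (∀ i, s i ∈ F) → (∀ i, t i ∈ F) → (d.2 (h ∘ s) ↔ d.2 (h ∘ t)) := by
  classical
  -- A predicate on increasing tuples becomes one on finite sets; a set has only one increasing
  -- enumeration, so the universal quantifier is harmless.
  let toSet : (Σ n : ℕ, (Fin n → ℕ) → Prop) → ℕ × (Finset ℕ → Prop) := fun d =>
    (d.1, fun S => ∀ v : Fin d.1 → ℕ, StrictMono v → Finset.univ.image v = S → d.2 v)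
  obtain ⟨H, hc, hH⟩ := exists_finset_homogeneous (D.image toSet) F.card
  let h : K → ℕ := fun x => if hx : x ∈ F then
    H.orderEmbOfFin hc ((F.orderIsoOfFin rfl).symm ⟨x, hx⟩) else 0
  have hmono : StrictMonoOn h F := by
    intro x hx y hy hxy
    have hx' : x ∈ F := hx
    have hy' : y ∈ F := hy
    simp only [h, dif_pos hx', dif_pos hy']
    exact (H.orderEmbOfFin hc).strictMono ((F.orderIsoOfFin rfl).symm.strictMono hxy)
  refine ⟨h, hmono, fun d hd => ?_⟩
  have key : ∀ s : Fin d.1 → K, StrictMono s → (∀ i, s i ∈ F) →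
      (d.2 (h ∘ s) ↔ ultraTruth (toSet d).2 d.1 ∅) := by
    intro s hs hsF
    have hst : StrictMono (h ∘ s) := fun i j hij => hmono (hsF i) (hsF j) (hs hij)
    have hcard : (Finset.univ.image (h ∘ s)).card = d.1 := by
      rw [Finset.card_image_of_injective _ hst.injective]; simp
    have := hH (toSet d) (Finset.mem_image_of_mem _ hd) (Finset.univ.image (h ∘ s)) (by
      intro y hy
      obtain ⟨i, -, rfl⟩ := Finset.mem_image.1 hy
      simp only [h, Function.comp, dif_pos (hsF i)]
      exact Finset.orderEmbOfFin_mem _ _ _) hcard.le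
    rw [hcard] at this
    simp only [toSet, Nat.sub_self, ultraTruth] at this
    refine Iff.trans ⟨fun hd' v hv himg => ?_, fun hv => hv _ hst rfl⟩ this
    have : v = h ∘ s := by
      rw [← hv.range_inj hst]
      have := congrArg (fun S : Finset ℕ => (S : Set ℕ)) himg
      simpa only [Finset.coe_image, Finset.coe_univ, Set.image_univ] using this
    rwa [this]
  intro s t hs ht hsF htF
  rw [key s hs hsF, key t ht htF]

/-- Ehrenfeucht–Mostowski: from sequences indexed by `ℕ` satisfying (finite parts of) the type `p`
and a pattern `ψ`, one gets an indiscernible sequence over any linear order `K` with the same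
properties. -/
theorem exists_indiscernible_pattern {T : L.Theory} {ι β : Type u} {m : ℕ}
    (ψ : ι → L.Formula (Fin m ⊕ β)) (p : Set (L.Formula β))
    (h : ∀ Θ ⊆ p, Θ.Finite →
      ∃ (M : FirstOrder.Language.Theory.ModelType.{u, u, u} T) (a : ℕ → β → M)
        (c : (ι → ℕ) → Fin m → M),
        (∀ η i t, (ψ i).Realize (Sum.elim (c η) (a t)) ↔ η i = t) ∧
          ∀ t, ∀ φ ∈ Θ, φ.Realize (a t)) (K : Type u) [LinearOrder K] :
    ∃ (M : FirstOrder.Language.Theory.ModelType.{u, u, u} T) (a : K → β → M)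
      (c : (ι → K) → Fin m → M),
      (∀ η i t, (ψ i).Realize (Sum.elim (c η) (a t)) ↔ η i = t) ∧
        (∀ t, ∀ φ ∈ p, φ.Realize (a t)) ∧ IndiscernibleOver L (∅ : Set M) a := by
  classical
  -- Variables for the entries of the `a t` and of the `c η`. `Q1` expresses the pattern, `Q2` the
  -- type `p`, and `Q3` indiscernibility.
  let V : Type u := (K × β) ⊕ ((ι → K) × Fin m)
  let pat : (ι → K) × ι × K → L.Formula V := fun x =>
    (ψ x.2.1).relabel (Sum.elim (fun j => Sum.inr (x.1, j)) (fun y => Sum.inl (x.2.2, y)))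
  let Q1 : (ι → K) × ι × K → L.Formula V := fun x =>
    if x.1 x.2.1 = x.2.2 then pat x else (pat x).not
  let Q2 : p × K → L.Formula V := fun x => x.1.1.relabel (fun y => Sum.inl (x.2, y))
  let ins : (n : ℕ) → (Fin n ↪o K) → L.Formula (Fin n × β) → L.Formula V := fun n s φ =>
    φ.relabel (fun y => Sum.inl (s y.1, y.2))
  let Q3 : (Σ n : ℕ, (Fin n ↪o K) × (Fin n ↪o K) × L.Formula (Fin n × β)) → L.Formula V :=
    fun x => (ins x.1 x.2.1 x.2.2.2).iff (ins x.1 x.2.2.1 x.2.2.2)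
  have hpat : ∀ (M : Type u) [L.Structure M] (v : V → M) x, (pat x).Realize v ↔
      (ψ x.2.1).Realize (Sum.elim (fun j => v (Sum.inr (x.1, j)))
        (fun y => v (Sum.inl (x.2.2, y)))) := by
    intro M _ v x
    simp only [pat, Language.Formula.realize_relabel]
    refine iff_of_eq (congrArg _ ?_)
    funext z; cases z <;> rfl
  have hQ1 : ∀ (M : Type u) [L.Structure M] (v : V → M) x, (Q1 x).Realize v ↔
      ((ψ x.2.1).Realize (Sum.elim (fun j => v (Sum.inr (x.1, j)))
        (fun y => v (Sum.inl (x.2.2, y)))) ↔ x.1 x.2.1 = x.2.2) := by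
    intro M _ v x
    by_cases hx : x.1 x.2.1 = x.2.2
    · simp [Q1, hx, hpat]
    · simp [Q1, hx, hpat, Language.Formula.realize_not]
  have hQ2 : ∀ (M : Type u) [L.Structure M] (v : V → M) x, (Q2 x).Realize v ↔
      x.1.1.Realize (fun y => v (Sum.inl (x.2, y))) := fun M _ v x =>
    Language.Formula.realize_relabel
  have hQ3 : ∀ (M : Type u) [L.Structure M] (v : V → M) x, (Q3 x).Realize v ↔
      (x.2.2.2.Realize (fun y => v (Sum.inl (x.2.1 y.1, y.2))) ↔
        x.2.2.2.Realize (fun y => v (Sum.inl (x.2.2.1 y.1, y.2)))) := by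
    intro M _ v x
    simp only [Q3, ins, Language.Formula.realize_iff, Language.Formula.realize_relabel]
    rfl
  have hsat : Sat T (Set.range (Sum.elim Q1 (Sum.elim Q2 Q3))) := by
    refine sat_range_of_finset fun J => ?_
    -- All points of `K` mentioned by `J`, including the values `η i`. The map `g : K → ℕ` below is
    -- injective on `F`, so replacing `η` by `g ∘ η` preserves the relevant equations `η i = t`.
    let F : Finset K := J.biUnion (fun x => match x with
      | Sum.inl x => {x.2.2, x.1 x.2.1}
      | Sum.inr (Sum.inl x) => {x.2}
      | Sum.inr (Sum.inr x) => Finset.univ.image x.2.1 ∪ Finset.univ.image x.2.2.1)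
    obtain ⟨M, a, c, hpatt, htype⟩ := h {φ | φ ∈ p ∧ ∃ t hφ, Sum.inr (Sum.inl (⟨φ, hφ⟩, t)) ∈ J}
      (fun φ hφ => hφ.1) ((J.finite_toSet.image (fun x => match x with
        | Sum.inr (Sum.inl x) => x.1.1
        | _ => ⊥)).subset (by rintro φ ⟨-, t, hφ, hx⟩; exact ⟨_, hx, rfl⟩))
    let D : Finset (Σ n : ℕ, (Fin n → ℕ) → Prop) := J.biUnion (fun x => match x with
      | Sum.inr (Sum.inr x) => {⟨x.1, fun s => x.2.2.2.Realize (fun y => a (s y.1) y.2)⟩}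
      | _ => ∅)
    obtain ⟨g, hg, hD⟩ := exists_strictMonoOn_homogeneous F D
    refine ⟨M, Sum.elim (fun x => a (g x.1) x.2) (fun x => c (g ∘ x.1) x.2), ?_⟩
    rintro _ ⟨x | x | x, hx, rfl⟩
    · refine (hQ1 _ _ _).2 ?_
      have h1 : x.2.2 ∈ F := Finset.mem_biUnion.2 ⟨_, hx, by simp⟩
      have h2 : x.1 x.2.1 ∈ F := Finset.mem_biUnion.2 ⟨_, hx, by simp⟩
      exact (hpatt (g ∘ x.1) x.2.1 (g x.2.2)).trans
        ⟨fun e => hg.injOn h2 h1 e, fun e => congrArg g e⟩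
    · exact (hQ2 _ _ _).2 (htype (g x.2) x.1.1 ⟨x.1.2, _, _, hx⟩)
    · refine (hQ3 _ _ _).2 ?_
      exact hD _ (Finset.mem_biUnion.2 ⟨_, hx, Finset.mem_singleton_self _⟩) x.2.1 x.2.2.1
        x.2.1.strictMono x.2.2.1.strictMono
        (fun i => Finset.mem_biUnion.2 ⟨_, hx, by simp⟩)
        (fun i => Finset.mem_biUnion.2 ⟨_, hx, by simp⟩)
  obtain ⟨M, v, hv⟩ := hsat
  refine ⟨M, fun t x => v (Sum.inl (t, x)), fun η j => v (Sum.inr (η, j)), fun η i t => ?_,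
    fun t φ hφ => ?_, fun n s t => ?_⟩
  · exact (hQ1 M v (η, i, t)).1 (hv _ ⟨Sum.inl (η, i, t), rfl⟩)
  · exact (hQ2 M v (⟨φ, hφ⟩, t)).1 (hv _ ⟨Sum.inr (Sum.inl (⟨φ, hφ⟩, t)), rfl⟩)
  · ext φ
    let φ' : L.Formula (Fin n × β) := φ.relabel (Sum.elim (fun x => x.2.elim) id)
    have := (hQ3 M v ⟨n, s, t, φ'⟩).1 (hv _ ⟨Sum.inr (Sum.inr ⟨n, s, t, φ'⟩), rfl⟩)
    simp only [φ', Language.Formula.realize_relabel] at this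
    have e : ∀ w : Fin n × β → M, w ∘ (Sum.elim (fun x : (∅ : Set M) => x.2.elim) id) =
        Sum.elim (fun c : (∅ : Set M) => (c : M)) w := by
      intro w; funext z
      rcases z with z | z
      · exact z.2.elim
      · rfl
    rw [e, e] at this
    exact this

/-! ### Existence of saturated models -/

/-- Small parameter sets are indexed by proper initial segments of `θ`, so that at most `θ` many
arities suffice for the formal terms. -/
theorem exists_Iio_equiv {θ : Cardinal.{u}} {A : Type u} (hA : #A < θ) :
    ∃ i : θ.ord.ToType, Nonempty (Set.Iio i ≃ A) := by
  have hlt : Ordinal.type ((· < ·) : (#A).ord.ToType → (#A).ord.ToType → Prop) <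
      Ordinal.type ((· < ·) : θ.ord.ToType → θ.ord.ToType → Prop) := by
    rw [Ordinal.type_toType, Ordinal.type_toType]; exact Cardinal.ord_lt_ord.2 hA
  obtain ⟨f⟩ := Ordinal.type_lt_iff.1 hlt
  refine ⟨f.top, ⟨?_⟩⟩
  have e1 : A ≃ (#A).ord.ToType := (Cardinal.eq.1 (by simp : #A = #(#A).ord.ToType)).some
  have e2 : (#A).ord.ToType ≃ Set.range f := Equiv.ofInjective f f.injective
  have e3 : Set.range f = Set.Iio f.top := by
    ext b; exact f.mem_range_iff_rel
  exact ((Equiv.setCongr e3).symm.trans e2.symm).trans e1.symm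

theorem mk_formula_lt {θ : Cardinal.{u}} (hθ : max (ℵ₀ : Cardinal.{u}) L.card < θ) {X : Type u}
    (hX : #X < θ) : #(L.Formula X) < θ := by
  have h1 : #(L.Formula X) ≤ #(Σ n, L.BoundedFormula X n) :=
    Cardinal.mk_le_of_injective (f := fun φ => ⟨0, φ⟩) (fun φ ψ h => by simpa using h)
  refine (h1.trans Language.BoundedFormula.card_le).trans_lt ?_
  rw [Cardinal.lift_id, Cardinal.lift_id]
  have h0 : ℵ₀ < θ := (le_max_left _ _).trans_lt hθ
  exact max_lt h0 (add_lt_of_lt h0.le hX ((le_max_right _ _).trans_lt hθ))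

theorem mk_Iio_lt_of_ord {θ : Cardinal.{u}} (i : θ.ord.ToType) : #(Set.Iio i) < θ := by
  simpa using Cardinal.mk_Iio_lt i (by simp)

section Terms

variable (L) (θ : Cardinal.{u}) (β : Type u)

/-- Labels: a set of formulas in one variable over fewer than `θ` parameters, or a constant. -/
abbrev SatLabel : Type u := (Σ i : θ.ord.ToType, Set (L.Formula (Set.Iio i ⊕ Unit))) ⊕ β

/-- The arity of a label. -/
def satArity : SatLabel L θ β → Type u
  | Sum.inl x => Set.Iio x.1
  | Sum.inr _ => PEmpty

/-- Formal names for the elements of a saturated model generated by `β`. -/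
abbrev SatTerm : Type u := WType (satArity L θ β)

variable {L θ β}

/-- The name of a realization of `p` over the parameters named by `f`. -/
abbrev SatTerm.node (i : θ.ord.ToType) (p : Set (L.Formula (Set.Iio i ⊕ Unit)))
    (f : Set.Iio i → SatTerm L θ β) : SatTerm L θ β :=
  WType.mk (Sum.inl ⟨i, p⟩ : SatLabel L θ β) f

/-- The name of an element of `β`. -/
abbrev SatTerm.leaf (b : β) : SatTerm L θ β :=
  WType.mk (Sum.inr b : SatLabel L θ β) PEmpty.elim

/-- The immediate subterm relation. -/
def SatTerm.Child (v w : SatTerm L θ β) : Prop :=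
  match w with
  | WType.mk _ f => ∃ k, f k = v

theorem SatTerm.child_wellFounded :
    WellFounded (SatTerm.Child : SatTerm L θ β → SatTerm L θ β → Prop) := by
  refine ⟨fun w => ?_⟩
  induction w with
  | mk x f ih => exact ⟨_, by rintro _ ⟨k, rfl⟩; exact ih k⟩

/-- The formulas saying that the element named by the term realizes the type in its label. -/
def SatTerm.req : SatTerm L θ β → Set (L.Formula (SatTerm L θ β))
  | WType.mk (Sum.inl ⟨i, p⟩) f =>
    (fun φ : L.Formula (Set.Iio i ⊕ Unit) =>
      φ.relabel (Sum.elim f (fun _ => SatTerm.node i p f))) '' p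
  | WType.mk (Sum.inr _) _ => ∅

/-- From `κ ^< θ = κ` one gets `2 ^ μ ≤ κ` for `μ < θ`, hence `θ ≤ κ` and at most `κ` labels. As all
arities are below `θ`, one application of the constructors does not lead beyond cardinality `κ`, and
the bound for W-types applies. -/
theorem mk_satTerm_le (hθ : max (ℵ₀ : Cardinal.{u}) L.card < θ) {κ : Cardinal.{u}} (hκ : ℵ₀ ≤ κ)
    (hκθ : κ ^< θ = κ) (hβ : #β ≤ κ) : #(SatTerm L θ β) ≤ κ := by
  have h2 : ∀ μ < θ, (2 : Cardinal.{u}) ^ μ ≤ κ := fun μ hμ =>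
    (Cardinal.power_le_power_right ((Cardinal.natCast_lt_aleph0 (n := 2)).le.trans hκ)).trans
      ((le_powerlt κ hμ).trans hκθ.le)
  have hθκ : θ ≤ κ := le_of_forall_lt fun μ hμ => (cantor μ).trans_le (h2 μ hμ)
  have h0 : ℵ₀ < θ := (le_max_left _ _).trans_lt hθ
  have hlab : #(SatLabel L θ β) ≤ κ := by
    rw [mk_sum, lift_id, lift_id, mk_sigma]
    refine add_le_of_le hκ ?_ hβ
    refine (sum_le_sum _ (fun _ => κ) fun i => ?_).trans ?_
    · rw [mk_set]
      exact h2 _ (mk_formula_lt hθ (by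
        rw [mk_sum, lift_uzero]
        exact add_lt_of_lt h0.le (mk_Iio_lt_of_ord i)
          ((by simp : Cardinal.lift.{u} #Unit < ℵ₀).trans h0)))
    · rw [sum_const', mk_ord_toType]
      exact mul_le_of_le hκ hθκ le_rfl
  refine WType.cardinalMk_le_of_le ((sum_le_sum _ (fun _ => κ) fun x => ?_).trans ?_)
  · rcases x with ⟨i, p⟩ | b
    · exact (le_powerlt κ (mk_Iio_lt_of_ord i)).trans hκθ.le
    · change κ ^ #PEmpty ≤ κ
      rw [mk_eq_zero, power_zero]
      exact one_le_aleph0.trans hκ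
  · rw [sum_const']
    exact mul_le_of_le hκ hlab le_rfl

end Terms

/-- A valuation of the terms in a model such that every type in a label which is finitely
satisfiable is realized by the term carrying the label. -/
theorem exists_satTerm_valuation {T : L.Theory} (θ : Cardinal.{u}) {β : Type u}
    (M₀ : FirstOrder.Language.Theory.ModelType.{u, u, u} T) (b : β → M₀) :
    ∃ (N : FirstOrder.Language.Theory.ModelType.{u, u, u} T) (v : SatTerm L θ β → N),
      (∀ φ : L.Formula β, φ.Realize (fun x => v (SatTerm.leaf x)) ↔ φ.Realize b) ∧
      ∀ (i : θ.ord.ToType) (p : Set (L.Formula (Set.Iio i ⊕ Unit)))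
        (f : Set.Iio i → SatTerm L θ β),
        (∀ q ⊆ p, q.Finite → ∃ x : N, ∀ φ ∈ q,
          φ.Realize (Sum.elim (fun k => v (f k)) (fun _ => x))) →
        ∀ φ ∈ p, φ.Realize (Sum.elim (fun k => v (f k)) (fun _ => v (SatTerm.node i p f))) := by
  classical
  let W := SatTerm L θ β
  have : IsWellFounded W SatTerm.Child := ⟨SatTerm.child_wellFounded⟩
  -- A well-order in which the parameters of a term precede the term.
  let _ : LinearOrder W := IsWellFounded.wellOrderExtension (SatTerm.Child : W → W → Prop)
  have hwf : WellFounded ((· < ·) : W → W → Prop) :=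
    (IsWellFounded.wellOrderExtension.isWellFounded_lt (SatTerm.Child : W → W → Prop)).wf
  have hchild : ∀ v w : W, SatTerm.Child v w → v < w := fun v w h =>
    Prod.Lex.left _ _ (IsWellFounded.rank_lt_of_rel h)
  let Q0 : Set (L.Formula W) :=
    (fun φ : L.Formula β => φ.relabel SatTerm.leaf) '' {φ | φ.Realize b}
  -- Greedy recursion: the requirement of `w` is adopted if it is consistent with the type of `b`
  -- and the requirements adopted earlier.
  let G : W → Prop := hwf.fix fun w ih =>
    Sat T (Q0 ∪ {φ | ∃ v, ∃ h : v < w, ih v h ∧ φ ∈ SatTerm.req v} ∪ SatTerm.req w)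
  have hG : ∀ w, G w ↔ Sat T (Q0 ∪ {φ | ∃ v, v < w ∧ G v ∧ φ ∈ SatTerm.req v} ∪
      SatTerm.req w) := by
    intro w
    have : G w = Sat T (Q0 ∪ {φ | ∃ v, ∃ _ : v < w, G v ∧ φ ∈ SatTerm.req v} ∪
      SatTerm.req w) := hwf.fix_eq _ w
    rw [this]
    simp only [exists_prop]
  -- A finite part involves finitely many adopted terms, and the adoption of the largest of them
  -- gives consistency.
  have hsat : Sat T (Q0 ∪ {φ | ∃ v, G v ∧ φ ∈ SatTerm.req v}) := by
    refine sat_of_finite fun q hq hfin => ?_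
    have : ∃ s : Finset W, (∀ w ∈ s, G w) ∧ q ⊆ Q0 ∪ {φ | ∃ v ∈ s, φ ∈ SatTerm.req v} := by
      refine Set.Finite.induction_on_subset (motive := fun r _ => ∃ s : Finset W,
        (∀ w ∈ s, G w) ∧ r ⊆ Q0 ∪ {φ | ∃ v ∈ s, φ ∈ SatTerm.req v}) q hfin
        ⟨∅, by simp, by simp⟩ ?_
      rintro φ r hφ - - ⟨s, hs, hr⟩
      rcases hq hφ with h | ⟨v, hv, hvφ⟩
      · exact ⟨s, hs, Set.insert_subset (Or.inl h) hr⟩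
      · refine ⟨insert v s, ?_, Set.insert_subset
          (Or.inr ⟨v, Finset.mem_insert_self _ _, hvφ⟩) ?_⟩
        · intro w hw
          rcases Finset.mem_insert.1 hw with rfl | hw
          exacts [hv, hs w hw]
        · intro ψ hψ
          rcases hr hψ with h | ⟨w, hw, h⟩
          exacts [Or.inl h, Or.inr ⟨w, Finset.mem_insert_of_mem hw, h⟩]
    obtain ⟨s, hs, hqs⟩ := this
    rcases s.eq_empty_or_nonempty with rfl | hne
    · refine Sat.mono (Q' := Q0) ?_ (fun φ hφ => ?_)
      · have : Nonempty M₀ := inferInstance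
        refine ⟨M₀, fun w => match w with
          | WType.mk (Sum.inr x) _ => b x
          | _ => Classical.arbitrary M₀, ?_⟩
        rintro _ ⟨φ, hφ, rfl⟩
        exact Language.Formula.realize_relabel.2 hφ
      · simpa using hqs hφ
    · refine ((hG (s.max' hne)).1 (hs _ (s.max'_mem hne))).mono fun φ hφ => ?_
      rcases hqs hφ with h | ⟨v, hv, h⟩
      · exact Or.inl (Or.inl h)
      · rcases (s.le_max' v hv).eq_or_lt with e | e
        · exact Or.inr (e ▸ h)
        · exact Or.inl (Or.inr ⟨v, e, hs v hv, h⟩)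
  obtain ⟨N, v, hv⟩ := hsat
  have hv0 : ∀ φ : L.Formula β, φ.Realize b → φ.Realize (fun x => v (SatTerm.leaf x)) := by
    intro φ hφ
    exact Language.Formula.realize_relabel.1 (hv _ (Or.inl ⟨φ, hφ, rfl⟩))
  have hreq : ∀ (N : Type u) [L.Structure N] (v : W → N) (i : θ.ord.ToType)
      (f : Set.Iio i → W) (w : W) (φ : L.Formula (Set.Iio i ⊕ Unit)),
      (Language.Formula.relabel (Sum.elim f (fun _ => w)) φ).Realize v ↔
        φ.Realize (Sum.elim (fun k => v (f k)) (fun _ => v w)) := by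
    intro N _ v i f w φ
    rw [Language.Formula.realize_relabel]
    refine iff_of_eq (congrArg _ ?_)
    funext z; cases z <;> rfl
  refine ⟨N, v, fun φ => ⟨fun h => ?_, hv0 φ⟩, fun i p f hp φ hφ => ?_⟩
  · by_contra hn
    exact (hv0 φ.not hn) h
  · have hGw : G (SatTerm.node i p f) := by
      rw [hG]
      refine sat_of_finite fun q hq hfin => ?_
      have hfin' : (q ∩ SatTerm.req (SatTerm.node i p f)).Finite :=
        hfin.subset Set.inter_subset_left
      obtain ⟨r, hr⟩ := hfin'.exists_finset_coe
      obtain ⟨s, hsp, hs⟩ := Finset.subset_set_image_iff.1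
        (hr.subset.trans Set.inter_subset_right)
      obtain ⟨x, hx⟩ := hp s hsp s.finite_toSet
      refine ⟨N, Function.update v (SatTerm.node i p f) x, fun ψ hψ => ?_⟩
      rcases hq hψ with (⟨φ, hφ, rfl⟩ | ⟨w, hw, hGw, hψw⟩) | hψw
      · rw [Language.Formula.realize_relabel]
        have : Function.update v (SatTerm.node i p f) x ∘ SatTerm.leaf =
            fun x => v (SatTerm.leaf x) := 
          funext fun y => Function.update_of_ne (fun h => by injection h with h; cases h) _ _
        rw [this]
        exact hv0 φ hφ
      · have h1 := hv ψ (Or.inr ⟨w, hGw, hψw⟩)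
        rcases w with ⟨⟨j, p'⟩ | y, g⟩
        · obtain ⟨φ, hφ, rfl⟩ := hψw
          have h2 := (hreq N v j g _ φ).1 h1
          refine (hreq N _ j g _ φ).2 ?_
          rw [Function.update_of_ne hw.ne]
          have h3 : ∀ k : Set.Iio j, Function.update v (SatTerm.node i p f) x (g k) = v (g k) :=
            fun k => Function.update_of_ne ((hchild (g k) (WType.mk (Sum.inl ⟨j, p'⟩) g)
              ⟨k, rfl⟩).trans hw).ne _ _
          rw [funext h3]
          exact h2
        · exact hψw.elim
      · have : ψ ∈ (r : Set _) := hr ▸ ⟨hψ, hψw⟩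
        rw [← hs] at this
        obtain ⟨φ, hφ, rfl⟩ := Finset.mem_image.1 this
        refine (hreq N _ i f _ φ).2 ?_
        rw [Function.update_self]
        have h3 : ∀ k, Function.update v (SatTerm.node i p f) x (f k) = v (f k) := fun k =>
          Function.update_of_ne (hchild (f k) (SatTerm.node i p f) ⟨k, rfl⟩).ne _ _
        rw [funext h3]
        exact hx φ hφ
    exact (hreq N v i f _ φ).1 (hv _ (Or.inr ⟨_, hGw, φ, hφ, rfl⟩))

/-- The values of the formal terms form the model. Parameters among these values are named by terms,
so a finitely satisfiable type over fewer than `θ` of them labels a term that realizes it. Applied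
to single formulas this is the Tarski–Vaught criterion; applied to all types it is saturation. -/
theorem exists_saturated_model {T : L.Theory} {θ κ : Cardinal.{u}}
    (hθ : max (ℵ₀ : Cardinal.{u}) L.card < θ) (hκ : ℵ₀ ≤ κ) (hκθ : κ ^< θ = κ) {β : Type u}
    (hβ : #β ≤ κ) (M₀ : FirstOrder.Language.Theory.ModelType.{u, u, u} T) (b : β → M₀) :
    ∃ N : FirstOrder.Language.Theory.ModelType.{u, u, u} T, #N ≤ κ ∧ IsSaturated L θ N ∧
      ∃ b' : β → N, ∀ φ : L.Formula β, φ.Realize b' ↔ φ.Realize b := by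
  obtain ⟨N₀, v, hb, hv⟩ := exists_satTerm_valuation θ M₀ b
  have hsatur : ∀ A : Type u, #A < θ → ∀ (g : A → N₀), (∀ x, g x ∈ Set.range v) →
      ∀ p : Set (L.Formula (A ⊕ Unit)), (∀ q ⊆ p, q.Finite → ∃ x : N₀, ∀ φ ∈ q,
        φ.Realize (Sum.elim g (fun _ => x))) →
      ∃ x ∈ Set.range v, ∀ φ ∈ p, φ.Realize (Sum.elim g (fun _ => x)) := by
    intro A hA g hg p hp
    choose f hf using hg
    obtain ⟨i, ⟨e⟩⟩ := exists_Iio_equiv hA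
    have hrel : ∀ (φ : L.Formula (A ⊕ Unit)) (x : N₀),
        (φ.relabel (Sum.map e.symm id)).Realize (Sum.elim (fun k => v (f (e k))) (fun _ => x)) ↔
          φ.Realize (Sum.elim g (fun _ => x)) := by
      intro φ x
      rw [Language.Formula.realize_relabel]
      refine iff_of_eq (congrArg _ ?_)
      funext z; cases z <;> simp [hf]
    have := hv i ((fun φ => φ.relabel (Sum.map e.symm id)) '' p) (fun k => f (e k)) (by
      intro q hq hfin
      obtain ⟨r, rfl⟩ := hfin.exists_finset_coe
      classical
      obtain ⟨s, hsp, rfl⟩ := Finset.subset_set_image_iff.1 hq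
      obtain ⟨x, hx⟩ := hp s hsp s.finite_toSet
      refine ⟨x, fun ψ hψ => ?_⟩
      obtain ⟨φ, hφ, rfl⟩ := Finset.mem_image.1 (Finset.mem_coe.1 hψ)
      exact (hrel φ x).2 (hx φ hφ))
    exact ⟨_, ⟨_, rfl⟩, fun φ hφ => (hrel φ _).1 (this _ ⟨φ, hφ, rfl⟩)⟩
  have h0 : ℵ₀ < θ := (le_max_left _ _).trans_lt hθ
  -- A definition uses finitely many parameters, so the one-formula type of its elements is realized
  -- in the range.
  have hmeet : L.MeetsDefinable (Set.range v) := by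
    rintro D ⟨y, hy⟩ hD
    obtain ⟨A₀, hA₀, hD'⟩ := Set.definable_iff_finitely_definable.1 hD
    obtain ⟨φ, hφ⟩ := Set.definable_iff_exists_formula_sum.1 hD'
    have hφ' : ∀ x : N₀, x ∈ D ↔ (φ.relabel (Sum.map id (fun _ => ()))).Realize
        (Sum.elim (fun c : (A₀ : Set N₀) => (c : N₀)) (fun _ : Unit => x)) := by
      intro x
      have : x ∈ D ↔ φ.Realize (Sum.elim (fun c : (A₀ : Set N₀) => (c : N₀)) (fun _ : Fin 1 => x)) :=
        Set.ext_iff.1 hφ (fun _ => x)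
      rw [Language.Formula.realize_relabel]
      refine this.trans (iff_of_eq (congrArg _ ?_))
      funext z; cases z <;> rfl
    obtain ⟨x, hx, hxp⟩ := hsatur (A₀ : Set N₀)
      ((Cardinal.lt_aleph0_iff_finite.2 A₀.finite_toSet).trans h0) (fun c => (c : N₀))
      (fun c => hA₀ c.2) {φ.relabel (Sum.map id (fun _ => ()))}
      (fun q hq _ => ⟨y, fun ψ hψ => by rw [Set.mem_singleton_iff.1 (hq hψ)]; exact (hφ' y).1 hy⟩)
    exact ⟨x, (hφ' x).2 (hxp _ rfl), hx⟩
  let N := hmeet.toElementarySubstructure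
  have hN : ∀ x, x ∈ N ↔ x ∈ Set.range v := fun x => by
    change x ∈ ((Language.Substructure.closure L (Set.range v) : L.Substructure N₀) : Set N₀) ↔ _
    rw [hmeet.closure_eq_self]
  have : N ⊨ T := (N.theory_model_iff T).2 inferInstance
  have hreal : ∀ {Y : Type u} (φ : L.Formula Y) (w : Y → N),
      φ.Realize (fun y => (w y : N₀)) ↔ φ.Realize w := fun φ w => N.subtype.map_formula φ w
  have hNsat : IsSaturated L θ N := by
    intro A hA p hp
    have helim : ∀ (x : N), (fun z => ((Sum.elim (fun c : A => c.1) (fun _ : Unit => x) z : N) : N₀)) =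
        Sum.elim (fun c : A => ((c.1 : N) : N₀)) (fun _ => (x : N₀)) := by
      intro x; funext z; cases z <;> rfl
    obtain ⟨x, hx, hxp⟩ := hsatur A hA (fun c : A => ((c.1 : N) : N₀)) (fun c => (hN _).1 (c.1 : N).2) p
      (by
        intro q hq hfin
        obtain ⟨x, hx⟩ := hp q hq hfin
        refine ⟨x, fun φ hφ => ?_⟩
        rw [← helim]
        exact (hreal φ _).2 (hx φ hφ))
    refine ⟨⟨x, (hN x).2 hx⟩, fun φ hφ => (hreal φ _).1 ?_⟩
    rw [helim]
    exact hxp φ hφ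
  refine ⟨Language.Theory.ModelType.of T N, ?_, hNsat, fun x => ⟨v (SatTerm.leaf x), (hN _).2 ⟨_, rfl⟩⟩,
    fun φ => (hreal φ _).symm.trans (hb φ)⟩
  have hle : #N ≤ #(Set.range v) :=
    Cardinal.mk_le_of_injective (f := fun x : N => (⟨x, (hN _).1 x.2⟩ : Set.range v))
      (fun x y h => Subtype.ext (by simpa using h))
  exact (hle.trans mk_range_le).trans (mk_satTerm_le hθ hκ hκθ hβ)

/-! ### Patterns along indiscernible sequences -/

/-- A witness of `ℵ₀ < κ_ict(T)` whose formulas have an `m`-tuple `x` of variables. -/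
def IctPattern (T : L.Theory) (m : ℕ) : Prop :=
  ∃ (ι : Type u) (n : ι → ℕ) (φ : (i : ι) → L.Formula (Fin m ⊕ Fin (n i))),
    #ι = ℵ₀ ∧ ∃ Λ : Type u, Infinite Λ ∧ GammaConsistent T φ Λ

theorem hasIctWitness_aleph0_iff {T : L.Theory} :
    HasIctWitness T ℵ₀ ↔ ∃ m, IctPattern T m := by
  constructor
  · rintro ⟨ι, m, n, φ, h⟩; exact ⟨m, ι, n, φ, h⟩
  · rintro ⟨m, ι, n, φ, h⟩; exact ⟨ι, m, n, φ, h⟩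

/-- Over every linear order `K` there is an indiscernible sequence `a` in a model of `T`, satisfying
the formulas in `p`, and tuples `c η` such that `ψ_i(c η, a t)` holds exactly when `η i = t`. -/
def HasPattern (T : L.Theory) {ι β : Type u} {m : ℕ} (ψ : ι → L.Formula (Fin m ⊕ β))
    (p : Set (L.Formula β)) : Prop :=
  ∀ (K : Type u) [LinearOrder K],
    ∃ (M : FirstOrder.Language.Theory.ModelType.{u, u, u} T) (a : K → β → M)
      (c : (ι → K) → Fin m → M),
      (∀ η i t, (ψ i).Realize (Sum.elim (c η) (a t)) ↔ η i = t) ∧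
        (∀ t, ∀ φ ∈ p, φ.Realize (a t)) ∧ IndiscernibleOver L (∅ : Set M) a

/-- The countably many finite parameter tuples for one `t` are concatenated into a single tuple, and
`ℕ` is embedded into `Λ`, before Ramsey's theorem is applied. -/
theorem IctPattern.hasPattern {T : L.Theory} {m : ℕ} (h : IctPattern T m) :
    ∃ (ι β : Type u) (ψ : ι → L.Formula (Fin m ⊕ β)), #ι = ℵ₀ ∧ #β ≤ ℵ₀ ∧ HasPattern T ψ ∅ := by
  obtain ⟨ι, n, φ, hι, Λ, hΛ, M, c, b, hφ⟩ := h
  refine ⟨ι, Σ i, Fin (n i), fun i => (φ i).relabel (Sum.map id (fun k => ⟨i, k⟩)), hι, ?_,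
    fun K _ => exists_indiscernible_pattern _ _ (fun Θ hΘ _ => ?_) K⟩
  · have : Countable ι := Cardinal.mk_le_aleph0_iff.1 hι.le
    exact Cardinal.mk_le_aleph0
  · let e := Infinite.natEmbedding Λ
    refine ⟨M, fun t x => b x.1 (e t) x.2, fun η => c (fun i => e (η i)), fun η i t => ?_,
      fun t φ hφ => (hΘ hφ).elim⟩
    rw [realize_sum_relabel, hφ]
    exact e.injective.eq_iff

/-- The members of the sequence of a pattern can be extended to realize the type of any tuple
extending a tuple with the same type. -/
theorem HasPattern.extend {T : L.Theory} {ι β : Type u} {m : ℕ} {ψ : ι → L.Formula (Fin m ⊕ β)}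
    (h : HasPattern T ψ ∅) : ∃ (M : FirstOrder.Language.Theory.ModelType.{u, u, u} T) (b : β → M),
      ∀ (α : Type u) (r : β → α), Function.Injective r →
      ∀ (N : FirstOrder.Language.Theory.ModelType.{u, u, u} T) (e : α → N),
      (∀ φ : L.Formula β, φ.Realize (e ∘ r) ↔ φ.Realize b) →
      HasPattern T (fun i => (ψ i).relabel (Sum.map id r)) {φ | φ.Realize e} := by
  classical
  obtain ⟨M, a, c, hpat, -, hind⟩ := h (ULift.{u} ℕ)
  refine ⟨M, a ⟨0⟩, fun α r hr N e he K _ => exists_indiscernible_pattern _ _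
    (fun Θ hΘ hfin => ?_) K⟩
  obtain ⟨χ, hχ⟩ := exists_formula_conj hfin
  -- Coordinates in the range of `r` refer to the old tuple; the others are quantified existentially
  -- in `δ`. The tuple `e ∘ r` satisfies `δ`, hence so does `b`, which is a term of the sequence,
  -- and by indiscernibility every `a t` does.
  let g : α → β ⊕ α := fun x => if hx : ∃ y, r y = x then Sum.inl hx.choose else Sum.inr x
  have hgr : ∀ y, g (r y) = Sum.inl y := by
    intro y
    have hx : ∃ z, r z = r y := ⟨y, rfl⟩
    simp only [g, dif_pos hx]
    exact congrArg _ (hr hx.choose_spec)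
  have hgo : ∀ x, (¬ ∃ y, r y = x) → g x = Sum.inr x := fun x hx => by simp only [g, dif_neg hx]
  obtain ⟨δ, hδ⟩ := exists_formula_ex (χ.relabel g)
  have h1 : δ.Realize (e ∘ r) := by
    refine (hδ N _).2 ⟨e, ?_⟩
    rw [Language.Formula.realize_relabel]
    have : Sum.elim (e ∘ r) e ∘ g = e := by
      funext x
      by_cases hx : ∃ y, r y = x
      · obtain ⟨y, rfl⟩ := hx; simp [hgr]
      · simp [hgo x hx]
    rw [this]
    exact (hχ N e).2 fun φ hφ => hΘ hφ
  have h2 : ∀ t, δ.Realize (a t) := fun t =>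
    (realize_move hind δ (fun _ => ⟨0⟩) (fun _ => t) id (by simp)).1 ((he δ).1 h1)
  choose w hw using fun t => (hδ M _).1 (h2 t)
  have hn : ∀ t y, (Sum.elim (a t) (w t) ∘ g) (r y) = a t y := fun t y => by simp [hgr]
  refine ⟨M, fun t => Sum.elim (a ⟨t⟩) (w ⟨t⟩) ∘ g, fun η => c (fun i => ⟨η i⟩),
    fun η i t => ?_, fun t => ?_⟩
  · rw [realize_sum_relabel]
    simp_rw [hn]
    rw [hpat]
    exact ULift.up_inj
  · exact (hχ M _).1 (Language.Formula.realize_relabel.1 (hw ⟨t⟩))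

/-! ### Enumerations of saturated models -/

theorem IsSaturated.exists_realize {θ : Cardinal.{u}} {N : Type u} [L.Structure N]
    (h : IsSaturated L θ N) {A : Type u} (hA : #A < θ) (g : A → N)
    {p : Set (L.Formula (A ⊕ Unit))} (hp : ∀ q ⊆ p, q.Finite → ∃ x : N, ∀ φ ∈ q,
      φ.Realize (Sum.elim g (fun _ => x))) :
    ∃ x : N, ∀ φ ∈ p, φ.Realize (Sum.elim g (fun _ => x)) := by
  classical
  have hrel : ∀ (φ : L.Formula (A ⊕ Unit)) (x : N),
      (φ.relabel (Sum.map (Set.rangeFactorization g) id)).Realize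
        (Sum.elim (fun c : Set.range g => (c : N)) (fun _ => x)) ↔
      φ.Realize (Sum.elim g (fun _ => x)) := by
    intro φ x
    rw [Language.Formula.realize_relabel]
    refine iff_of_eq (congrArg _ ?_)
    funext z; cases z <;> rfl
  obtain ⟨x, hx⟩ := h (Set.range g) (mk_range_le.trans_lt hA)
    ((fun φ => φ.relabel (Sum.map (Set.rangeFactorization g) id)) '' p) (by
      intro q hq hfin
      obtain ⟨r, rfl⟩ := hfin.exists_finset_coe
      obtain ⟨s, hsp, rfl⟩ := Finset.subset_set_image_iff.1 hq
      obtain ⟨x, hx⟩ := hp s hsp s.finite_toSet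
      refine ⟨x, fun ψ hψ => ?_⟩
      obtain ⟨φ, hφ, rfl⟩ := Finset.mem_image.1 (Finset.mem_coe.1 hψ)
      exact (hrel φ x).2 (hx φ hφ))
  exact ⟨x, fun φ hφ => (hrel φ x).1 (hx _ ⟨φ, hφ, rfl⟩)⟩

theorem IsSaturated.of_equiv {θ : Cardinal.{u}} {N N' : Type u} [L.Structure N] [L.Structure N']
    (h : IsSaturated L θ N) (e : N ≃[L] N') : IsSaturated L θ N' := by
  intro A hA p hp
  have key : ∀ (φ : L.Formula (A ⊕ Unit)) (x : N),
      φ.Realize (Sum.elim (fun c : A => (c : N')) (fun _ => e x)) ↔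
        φ.Realize (Sum.elim (fun c : A => e.symm c) (fun _ => x)) := by
    intro φ x
    rw [← e.toElementaryEmbedding.map_formula]
    refine iff_of_eq (congrArg _ ?_)
    funext z; cases z <;> simp
  obtain ⟨x, hx⟩ := h.exists_realize hA (fun c : A => e.symm c) (p := p) (by
    intro q hq hfin
    obtain ⟨x, hx⟩ := hp q hq hfin
    refine ⟨e.symm x, fun φ hφ => (key φ _).1 ?_⟩
    rw [e.apply_symm_apply]
    exact hx φ hφ)
  exact ⟨e x, fun φ hφ => (key φ x).2 (hx φ hφ)⟩

/-- Equalities between coordinates belong to the type, so `e x ↦ v x` is a well-defined elementary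
embedding; its image is `Set.range v`, isomorphic to `N`. -/
theorem enumeratesSaturated_of_type {θ : Cardinal.{u}} {α N M : Type u} [L.Structure N]
    [L.Structure M] (hN : IsSaturated L θ N) {e : α → N} (he : Function.Surjective e) {v : α → M}
    (hv : ∀ φ : L.Formula α, φ.Realize e → φ.Realize v) : EnumeratesSaturated L θ v := by
  have hv' : ∀ φ : L.Formula α, φ.Realize v ↔ φ.Realize e := fun φ =>
    ⟨fun h => by_contra fun hn => hv φ.not hn h, hv φ⟩
  choose g hg using he
  let F : N ↪ₑ[L] M :=
    { toFun := fun y => v (g y)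
      map_formula' := fun n φ x => by
        have := hv' (φ.relabel (fun k => g (x k)))
        rw [Language.Formula.realize_relabel, Language.Formula.realize_relabel] at this
        refine Iff.trans this (iff_of_eq (congrArg _ ?_))
        funext k; exact hg _ }
  have hF : ∀ x, v x = F (e x) := by
    intro x
    have := hv' (Language.Term.equal (Language.Term.var x) (Language.Term.var (g (e x))))
    simp only [Language.Formula.realize_equal, Language.Term.realize_var] at this
    exact this.2 (hg _).symm
  let E : N ≃[L] F.toEmbedding.toHom.range := F.toEmbedding.equivRange
  have hE : ∀ y, (E y : M) = F y := fun y => rfl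
  refine ⟨⟨F.toEmbedding.toHom.range, fun n φ x => ?_⟩, ?_, hN.of_equiv E⟩
  · have h1 := E.toElementaryEmbedding.map_formula φ (fun k => E.symm (x k))
    have h2 := F.map_formula φ (fun k => E.symm (x k))
    have e1 : (E.toElementaryEmbedding ∘ fun k => E.symm (x k)) = x := by
      funext k; exact E.apply_symm_apply _
    have e2 : (F ∘ fun k => E.symm (x k)) = ((↑) : _ → M) ∘ x := by
      funext k
      simp only [Function.comp]
      rw [← hE, E.apply_symm_apply]
    rw [e1] at h1
    rw [e2] at h2
    exact h2.trans h1.symm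
  · ext y
    constructor
    · rintro ⟨x, rfl⟩; exact ⟨e x, (hF x).symm⟩
    · rintro ⟨y, rfl⟩; exact ⟨g y, rfl⟩

/-- If `T` has a pattern, then it has one along sequences enumerating `θ`-saturated models. -/
theorem IctPattern.exists_saturated {T : L.Theory} {m : ℕ} (h : IctPattern T m) (α : Type u)
    [Infinite α] {θ : Cardinal.{u}} (hθ : max (ℵ₀ : Cardinal.{u}) L.card < θ)
    (hαθ : #α ^< θ = #α) :
    ∃ (ι : Type u) (ψ : ι → L.Formula (Fin m ⊕ α)) (p : Set (L.Formula α)), #ι = ℵ₀ ∧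
      HasPattern T ψ p ∧ ∀ (M : Type u) [L.Structure M] (v : α → M), (∀ φ ∈ p, φ.Realize v) →
        EnumeratesSaturated L θ v := by
  obtain ⟨ι, β, ψ, hι, hβ, hpat⟩ := h.hasPattern
  obtain ⟨M, b, hMb⟩ := hpat.extend
  have hα : ℵ₀ ≤ #α := Cardinal.aleph0_le_mk α
  obtain ⟨N, hN, hsat, b', hb'⟩ := exists_saturated_model hθ hα hαθ (hβ.trans hα) M b
  have hcard : #α = #(β ⊕ α) := by
    rw [mk_sum, lift_id, lift_id, add_eq_right hα (hβ.trans hα)]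
  obtain ⟨E⟩ := Cardinal.eq.1 hcard
  have : Nonempty N := inferInstance
  obtain ⟨f⟩ := Cardinal.le_def _ _ |>.1 hN
  -- `α` is split as `β ⊕ α`: the first part carries `b'`, and the second is large enough to
  -- enumerate all of `N`.
  let e : α → N := Sum.elim b' (Function.invFun f) ∘ E
  have he : Function.Surjective e := fun y => ⟨E.symm (Sum.inr (f y)), by
    simp [e, Function.leftInverse_invFun f.injective y]⟩
  refine ⟨ι, _, _, hι, hMb α (fun x => E.symm (Sum.inl x)) (fun x y h => by simpa using h) N e
    (fun φ => ?_), fun M' _ v hv => enumeratesSaturated_of_type hsat he hv⟩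
  rw [← hb']
  refine iff_of_eq (congrArg _ ?_)
  funext x; simp [e]

/-- If `T` has a pattern, then it has one along sequences of `α`-tuples. -/
theorem IctPattern.exists_infinite {T : L.Theory} {m : ℕ} (h : IctPattern T m) (α : Type u)
    [Infinite α] : ∃ (ι : Type u) (ψ : ι → L.Formula (Fin m ⊕ α)), #ι = ℵ₀ ∧
      HasPattern T ψ ∅ := by
  classical
  obtain ⟨ι, β, ψ, hι, hβ, hpat⟩ := h.hasPattern
  obtain ⟨M, b, hMb⟩ := hpat.extend
  obtain ⟨f⟩ := Cardinal.le_def _ _ |>.1 (hβ.trans (Cardinal.aleph0_le_mk α))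
  have : Nonempty M := inferInstance
  refine ⟨ι, fun i => (ψ i).relabel (Sum.map id f), hι, fun K _ => ?_⟩
  obtain ⟨M', a, c, h1, -, h3⟩ := hMb α f f.injective M
    (fun x => if hx : ∃ y, f y = x then b hx.choose else Classical.arbitrary M) (fun φ => by
      refine iff_of_eq (congrArg _ ?_)
      funext y
      have hx : ∃ z, f z = f y := ⟨y, rfl⟩
      simp only [Function.comp, dif_pos hx]
      exact congrArg b (f.injective hx.choose_spec)) K
  exact ⟨M', a, c, h1, fun _ _ h => h.elim, h3⟩

/-! ### Families generated by an indiscernible sequence of saturated models -/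

/-- In the order type of a successor cardinal `θ⁺`, every subset of size at most `θ` is bounded. -/
theorem exists_forall_lt_of_mk_le {θ : Cardinal.{u}} (hθ : ℵ₀ ≤ θ) {X : Type u} (hX : #X ≤ θ)
    (f : X → (Order.succ θ).ord.ToType) : ∃ j, ∀ x, f x < j := by
  by_contra! h
  have hcof : IsCofinal (Set.range f) := fun j => by
    obtain ⟨x, hx⟩ := h j
    exact ⟨f x, ⟨x, rfl⟩, hx⟩
  have h1 := Order.cof_le hcof
  rw [Ordinal.cof_toType, (Cardinal.isRegular_succ hθ).cof_ord] at h1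
  exact absurd ((h1.trans mk_range_le).trans hX) (not_le.2 (Order.lt_succ θ))

section Lex

variable {J₁ J₂ X : Type u} [LinearOrder J₁] [LinearOrder J₂] [LinearOrder X]

/-- The outer points of the sum `J₁ + X + J₂`. -/
def outerPt (j : J₁ ⊕ J₂) : J₁ ⊕ₗ (X ⊕ₗ J₂) :=
  Sum.elim (fun j => toLex (Sum.inl j)) (fun j => toLex (Sum.inr (toLex (Sum.inr j)))) j

/-- The inner points of the sum `J₁ + X + J₂`. -/
def innerPt (J₁ J₂ : Type u) (x : X) : J₁ ⊕ₗ (X ⊕ₗ J₂) :=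
  toLex (Sum.inr (toLex (Sum.inl x)))

theorem point_lt_iff {Y : Type*} (p : Y → X) (q : Y → X)
    (h : ∀ y z, p y < p z ↔ q y < q z) (y z : (J₁ ⊕ J₂) ⊕ Y) :
    Sum.elim (outerPt (X := X)) (fun y => innerPt J₁ J₂ (p y)) y <
        Sum.elim (outerPt (X := X)) (fun y => innerPt J₁ J₂ (p y)) z ↔
      Sum.elim (outerPt (X := X)) (fun y => innerPt J₁ J₂ (q y)) y <
        Sum.elim (outerPt (X := X)) (fun y => innerPt J₁ J₂ (q y)) z := by
  rcases y with (y | y) | y <;> rcases z with (z | z) | z <;>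
    simp [outerPt, innerPt, h]

end Lex

section Family

variable {M : Type u} [L.Structure M] {J α : Type u}

/-- The lengths of the tuples of the family: `b_∅` consists of the tuples with index in `J`, and
`b_u` is empty if `u` has more than one element. -/
def famLength (J α : Type u) : ℕ → Type u
  | 0 => J × α
  | 1 => α
  | _ + 2 => PEmpty

/-- The position of an entry of the family: an index in `J` or a point of the order, and the
place in the tuple. -/
def famCode {Y : Type*} : (k : ℕ) → (Fin k → Y) → famLength J α k → (J ⊕ Y) × α
  | 0, _, x => (Sum.inl x.1, x.2)
  | 1, ρ, x => (Sum.inr (ρ 0), x)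
  | _ + 2, _, x => x.elim

theorem famCode_comp {Y Z : Type*} (s : Y → Z) (k : ℕ) (ρ : Fin k → Y) (x : famLength J α k) :
    famCode k (s ∘ ρ) x = (Sum.map id s (famCode k ρ x).1, (famCode k ρ x).2) := by
  rcases k with _ | _ | k
  · rfl
  · rfl
  · exact x.elim

/-- The family made of a sequence of tuples indexed by `J` and a sequence of tuples indexed by
`X`. -/
def seqFamily {X : Type u} [LinearOrder X] (d : J → α → M) (a : X → α → M) :
    Family X (famLength J α) M :=
  fun k ρ x => Sum.elim d a (famCode k ρ x).1 (famCode k ρ x).2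

theorem mem_base_seqFamily {X : Type u} [LinearOrder X] (d : J → α → M) (a : X → α → M) (y : M) :
    y ∈ (seqFamily d a).base ↔ ∃ j x, d j x = y := by
  constructor
  · rintro ⟨ρ, x, rfl⟩; exact ⟨x.1, x.2, rfl⟩
  · rintro ⟨j, x, rfl⟩; exact ⟨OrderEmbedding.ofIsEmpty, (j, x), rfl⟩

theorem famCode_eq_inr {Y : Type*} {k : ℕ} {ρ : Fin k → Y} {x : famLength J α k} {y : Y}
    (h : (famCode k ρ x).1 = Sum.inr y) : ∃ i, ρ i = y := by
  rcases k with _ | _ | k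
  · exact absurd h (by simp [famCode])
  · exact ⟨0, by simpa [famCode] using h⟩
  · exact x.elim

/-- Every entry of the family, and every parameter in `A`, is a coordinate of `n` at some point.
Exchanging `s` for `t` fixes the outer points and moves only the inner ones, without changing their
order relative to anything. -/
theorem familyIndiscernibleOver_seqFamily {J₁ J₂ X Y : Type u} [LinearOrder J₁] [LinearOrder J₂]
    [LinearOrder X] [LinearOrder Y] {n : J₁ ⊕ₗ (X ⊕ₗ J₂) → α → M}
    (hn : IndiscernibleOver L (∅ : Set M) n) (p : Y ↪o X) {A : Set M}
    (hA : ∀ y ∈ A, ∃ (j : J₁ ⊕ J₂) (x : α), n (outerPt j) x = y) :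
    FamilyIndiscernibleOver L A
      (seqFamily (fun j => n (outerPt j)) (fun y => n (innerPt J₁ J₂ (p y)))) := by
  classical
  intro k s t
  choose j z hj using fun c : A => hA c c.2
  let code : A ⊕ (Σ i : ℕ, (Fin i ↪o Fin k) × famLength (J₁ ⊕ J₂) α i) →
      ((J₁ ⊕ J₂) ⊕ Fin k) × α :=
    Sum.elim (fun c => (Sum.inl (j c), z c)) (fun x => famCode x.1 x.2.1 x.2.2)
  have key : ∀ s : Fin k ↪o Y, Sum.elim (fun c : A => (c : M))
      (fun x : (Σ i : ℕ, (Fin i ↪o Fin k) × famLength (J₁ ⊕ J₂) α i) =>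
        seqFamily (fun j => n (outerPt j)) (fun y => n (innerPt J₁ J₂ (p y)))
          x.1 (x.2.1.trans s) x.2.2) =
      fun y => n (Sum.elim outerPt (fun i => innerPt J₁ J₂ (p (s i))) (code y).1) (code y).2 := by
    intro s
    funext y
    rcases y with c | ⟨i, ρ, x⟩
    · exact (hj c).symm
    · have := famCode_comp (J := J₁ ⊕ J₂) (α := α) s i ρ x
      change (Sum.elim (fun j => n (outerPt j)) (fun y => n (innerPt J₁ J₂ (p y))) :
        (J₁ ⊕ J₂) ⊕ Y → α → M) (famCode i (s ∘ ρ) x).1 (famCode i (s ∘ ρ) x).2 = _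
      rw [this]
      change (Sum.elim (fun j => n (outerPt j)) (fun y => n (innerPt J₁ J₂ (p y))) :
        (J₁ ⊕ J₂) ⊕ Y → α → M) (Sum.map id s (famCode i ρ x).1) (famCode i ρ x).2 =
        n (Sum.elim outerPt _ (famCode i ρ x).1) (famCode i ρ x).2
      rcases (famCode i (⇑ρ) x).1 with h | h <;> rfl
  ext φ
  change φ.Realize _ ↔ φ.Realize _
  rw [key, key]
  refine realize_move hn φ _ _ _ fun y _ z _ => point_lt_iff _ _ (fun a b => ?_) _ _
  rw [p.lt_iff_lt, p.lt_iff_lt, s.lt_iff_lt, t.lt_iff_lt]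

end Family

section Shift

variable {J I : Type u} [LinearOrder J] [LinearOrder I]

/-- The order `ω + I + ω*`. -/
abbrev Padded (I : Type u) : Type u := ULift.{u} ℕ ⊕ₗ (I ⊕ₗ (ULift.{u} ℕ)ᵒᵈ)

/-- The points of `J + (ω + I + ω*) + J*`. -/
def paddedPt : (J ⊕ Jᵒᵈ) ⊕ Padded I → J ⊕ₗ (Padded I ⊕ₗ Jᵒᵈ) :=
  Sum.elim outerPt (innerPt J Jᵒᵈ)

/-- Move the points of `ω` into `J` and those of `ω*` into `J*`. -/
def shiftPt (h : ℕ → J) : (J ⊕ Jᵒᵈ) ⊕ Padded I → (J ⊕ Jᵒᵈ) ⊕ Padded I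
  | Sum.inl j => Sum.inl j
  | Sum.inr (Sum.inlₗ i) => Sum.inl (Sum.inl (h i.down))
  | Sum.inr (Sum.inrₗ (Sum.inlₗ i)) => Sum.inr (Sum.inrₗ (Sum.inlₗ i))
  | Sum.inr (Sum.inrₗ (Sum.inrₗ i)) =>
    Sum.inl (Sum.inr (OrderDual.toDual (h (OrderDual.ofDual i).down)))

/-- A point of `J` or `J*` is bounded by `j₀`. -/
def PtBounded (j₀ : J) : (J ⊕ Jᵒᵈ) ⊕ Padded I → Prop
  | Sum.inl (Sum.inl j) => j < j₀
  | Sum.inl (Sum.inr j) => OrderDual.ofDual j < j₀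
  | Sum.inr _ => True

omit [LinearOrder I] in
theorem PtBounded.mono {j₀ j₁ : J} (h : j₀ ≤ j₁) {y : (J ⊕ Jᵒᵈ) ⊕ Padded I}
    (hy : PtBounded j₀ y) : PtBounded j₁ y := by
  rcases y with (j | j) | x
  · exact lt_of_lt_of_le hy h
  · exact lt_of_lt_of_le (α := J) hy h
  · trivial

/-- The order is `J < ω < I < ω* < J*`. Points of `ω` land in `J` above `j₀`, thus above all bounded
points of `J` and still below `I`; the other side is symmetric. -/
theorem shiftPt_lt_iff {h : ℕ → J} (hh : StrictMono h) {j₀ : J} (hj : ∀ k, j₀ ≤ h k)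
    {y z : (J ⊕ Jᵒᵈ) ⊕ Padded I} (hy : PtBounded j₀ y) (hz : PtBounded j₀ z) :
    paddedPt y < paddedPt z ↔ paddedPt (shiftPt h y) < paddedPt (shiftPt h z) := by
  have h1 : ∀ {j k}, j < j₀ → j < h k := fun hj' => hj'.trans_le (hj _)
  have h2 : ∀ {j k}, j < j₀ → ¬ h k < j := fun hj' => (h1 hj').not_gt
  have key : ∀ x : Padded I, (∃ i, x = Sum.inlₗ i) ∨ (∃ i, x = Sum.inrₗ (Sum.inlₗ i)) ∨
      ∃ i, x = Sum.inrₗ (Sum.inrₗ (OrderDual.toDual i)) := by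
    rintro (i | i | i)
    exacts [Or.inl ⟨i, rfl⟩, Or.inr (Or.inl ⟨i, rfl⟩), Or.inr (Or.inr ⟨i, rfl⟩)]
  have key' : ∀ y : (J ⊕ Jᵒᵈ) ⊕ Padded I, PtBounded j₀ y → (∃ j, j < j₀ ∧ y = Sum.inl (Sum.inl j)) ∨
      (∃ j, j < j₀ ∧ y = Sum.inl (Sum.inr (OrderDual.toDual j))) ∨ (∃ i, y = Sum.inr (Sum.inlₗ i)) ∨
      (∃ i, y = Sum.inr (Sum.inrₗ (Sum.inlₗ i))) ∨
      ∃ i, y = Sum.inr (Sum.inrₗ (Sum.inrₗ (OrderDual.toDual i))) := by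
    rintro ((j | j) | x) hb
    · exact Or.inl ⟨j, hb, rfl⟩
    · exact Or.inr (Or.inl ⟨_, hb, rfl⟩)
    · rcases key x with ⟨i, rfl⟩ | ⟨i, rfl⟩ | ⟨i, rfl⟩ <;> simp
  have e1 : ∀ j : J ⊕ Jᵒᵈ, shiftPt (I := I) h (Sum.inl j) = Sum.inl j := fun _ => rfl
  have e2 : ∀ i, shiftPt (I := I) h (Sum.inr (Sum.inlₗ i)) = Sum.inl (Sum.inl (h i.down)) :=
    fun _ => rfl
  have e3 : ∀ i, shiftPt (I := I) h (Sum.inr (Sum.inrₗ (Sum.inlₗ i))) =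
    Sum.inr (Sum.inrₗ (Sum.inlₗ i)) := fun _ => rfl
  have e4 : ∀ i, shiftPt (I := I) h (Sum.inr (Sum.inrₗ (Sum.inrₗ (OrderDual.toDual i)))) =
    Sum.inl (Sum.inr (OrderDual.toDual (h i.down))) := fun _ => rfl
  rcases key' y hy with ⟨j, hj', rfl⟩ | ⟨j, hj', rfl⟩ | ⟨⟨i⟩, rfl⟩ | ⟨i, rfl⟩ | ⟨⟨i⟩, rfl⟩ <;>
    rcases key' z hz with ⟨k, hk', rfl⟩ | ⟨k, hk', rfl⟩ | ⟨⟨k⟩, rfl⟩ | ⟨k, rfl⟩ | ⟨⟨k⟩, rfl⟩ <;>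
    simp [paddedPt, outerPt, innerPt, hh.lt_iff_lt, *]

end Shift

section InFamily

variable {M : Type u} [L.Structure M] {α : Type u}

/-- The base consists of the tuples at `J` and `J*`, and the extension of `I` is `ω + I + ω*`. To
realize a small part `q` of the type in the base, `ω` and `ω*` are moved into `J` and `J*` beyond
all points used by `q`. -/
theorem inSaturatedFamily_of_indiscernible {θ : Cardinal.{u}} (hθ : ℵ₀ ≤ θ) {I : Type u}
    [LinearOrder I] {J : Type u} [LinearOrder J]
    (hbd : ∀ {X : Type u}, #X ≤ θ → ∀ f : X → J, ∃ j, ∀ x, f x < j)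
    {n : J ⊕ₗ (Padded I ⊕ₗ Jᵒᵈ) → α → M}
    (hn : IndiscernibleOver L (∅ : Set M) n) (hsat : ∀ t, EnumeratesSaturated L θ (n t)) :
    InSaturatedFamily L θ (fun t : I => n (innerPt _ _ (midEmb _ I _ t))) := by
  have hbd1 : ∀ y : (J ⊕ Jᵒᵈ) ⊕ Padded I, ∃ j₀, PtBounded j₀ y := by
    have h1 : ∀ j : J, ∃ j₀, j < j₀ := fun j => by
      obtain ⟨j₀, h⟩ := hbd (X := PUnit) (by simpa using one_le_aleph0.trans hθ) (fun _ => j)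
      exact ⟨j₀, h ⟨⟩⟩
    rintro ((j | j) | x)
    · exact h1 j
    · exact h1 (OrderDual.ofDual j)
    · obtain ⟨j₀, -⟩ := hbd (X := PEmpty) (by simp) (fun x => x.elim)
      exact ⟨j₀, trivial⟩
  let d : J ⊕ Jᵒᵈ → α → M := fun j => n (outerPt j)
  let b : Family I (famLength (J ⊕ Jᵒᵈ) α) M :=
    seqFamily d (fun t : I => n (innerPt _ _ (midEmb _ I _ t)))
  let b' : Family (Padded I) (famLength (J ⊕ Jᵒᵈ) α) M :=
    seqFamily d (fun t => n (innerPt _ _ t))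
  have hbase : ∀ y ∈ b.base, ∃ (j : J ⊕ Jᵒᵈ) (x : α), n (outerPt j) x = y := fun y hy =>
    (mem_base_seqFamily _ _ y).1 hy
  refine ⟨famLength (J ⊕ Jᵒᵈ) α, b, familyIndiscernibleOver_seqFamily hn (midEmb _ I _) hbase,
    ⟨Equiv.refl α, fun ρ x => rfl⟩, fun t => hsat _, ULift.{u} ℕ, (ULift.{u} ℕ)ᵒᵈ, inferInstance,
    inferInstance, inferInstance, inferInstanceAs (Infinite (ULift.{u} ℕ)), b',
    familyIndiscernibleOver_seqFamily hn (RelEmbedding.refl _) hbase, fun k ρ => ?_,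
    fun B hB _ q hq hqθ => ?_⟩
  · rcases k with _ | _ | k
    · rfl
    · rfl
    · funext x; exact x.elim
  have hent : ∀ y ∈ B ∪ b.entries, ∃ (z : (J ⊕ Jᵒᵈ) ⊕ I) (x : α),
      n (paddedPt (Sum.map id (midEmb _ I _) z)) x = y := by
    rintro y (hy | ⟨k, ρ, x, rfl⟩)
    · obtain ⟨j, x, h⟩ := hbase y (hB hy)
      exact ⟨Sum.inl j, x, h⟩
    · refine ⟨(famCode k ρ x).1, (famCode k ρ x).2, ?_⟩
      change n (paddedPt (Sum.map id (midEmb _ I _) (famCode k ρ x).1)) (famCode k ρ x).2 =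
        (Sum.elim d (fun t : I => n (innerPt _ _ (midEmb _ I _ t))) : _ → α → M)
          (famCode k ρ x).1 (famCode k ρ x).2
      rcases (famCode k ρ x).1 with h | h <;> rfl
  choose cz cx hc using fun c : ↥(B ∪ b.entries) => hent c c.2
  let Vr : Type u := (Σ k : ℕ, {ρ : Fin k ↪o Padded I //
    ∀ i, ρ i ∉ Set.range (midEmb (ULift.{u} ℕ) I (ULift.{u} ℕ)ᵒᵈ)} × famLength (J ⊕ Jᵒᵈ) α k)
  let vc : Vr → ((J ⊕ Jᵒᵈ) ⊕ Padded I) × α := fun x => famCode x.1 x.2.1.1 x.2.2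
  let code : ↥(B ∪ b.entries) ⊕ Vr → (J ⊕ Jᵒᵈ) ⊕ Padded I :=
    Sum.elim (fun c => Sum.map id (midEmb _ I _) (cz c)) (fun x => (vc x).1)
  let pl : ↥(B ∪ b.entries) ⊕ Vr → α := Sum.elim cx (fun x => (vc x).2)
  classical
  -- Each formula uses finitely many points and hence has a bound in `J`; the bounds of the formulas
  -- in `q` have a common bound.
  have hφ : ∀ φ : q, ∃ j₀ : J, ∀ y ∈ φ.1.freeVarFinset, PtBounded j₀ (code y) := by
    intro φ
    choose f hf using fun y => hbd1 (code y)
    obtain ⟨j₀, hj₀⟩ := hbd (X := φ.1.freeVarFinset) ((Cardinal.mk_lt_aleph0).le.trans hθ)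
      (fun y => f y)
    exact ⟨j₀, fun y hy => (hf y).mono (hj₀ ⟨y, hy⟩).le⟩
  choose f hf using hφ
  obtain ⟨j₀, hj₀⟩ := hbd hqθ.le f
  have : NoMaxOrder J := ⟨fun j => by
    obtain ⟨j₁, h⟩ := hbd (X := PUnit) (by simpa using one_le_aleph0.trans hθ) (fun _ => j)
    exact ⟨j₁, h ⟨⟩⟩⟩
  obtain ⟨h, hh, h0⟩ := Nat.exists_strictMono' j₀
  have hge : ∀ k, j₀ ≤ h k := fun k => h0 ▸ hh.monotone (Nat.zero_le k)
  have horig : Sum.elim (fun c : ↥(B ∪ b.entries) => (c : M))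
      (fun x : Vr => b' x.1 x.2.1.1 x.2.2) = fun y => n (paddedPt (code y)) (pl y) := by
    funext y
    rcases y with c | x
    · exact (hc c).symm
    · change (Sum.elim d (fun t => n (innerPt _ _ t)) : _ → α → M) (vc x).1 (vc x).2 =
        n (paddedPt (vc x).1) (vc x).2
      rcases (vc x).1 with h | h <;> rfl
  refine ⟨fun x => n (paddedPt (shiftPt h (vc x).1)) (vc x).2, fun x => ?_, fun φ hφq => ?_⟩
  · have hout : ∃ j, paddedPt (shiftPt h (vc x).1) = outerPt j := by
      rcases hx : (vc x).1 with j | y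
      · exact ⟨j, rfl⟩
      · obtain ⟨i, rfl⟩ := famCode_eq_inr hx
        have hi := x.2.1.2 i
        generalize x.2.1.1 i = y at hi
        rcases y with y | y | y
        · exact ⟨Sum.inl (h y.down), rfl⟩
        · exact (hi ⟨y, rfl⟩).elim
        · exact ⟨Sum.inr (OrderDual.toDual (h (OrderDual.ofDual y).down)), rfl⟩
    obtain ⟨j, hj⟩ := hout
    simp only [hj]
    exact (mem_base_seqFamily _ _ _).2 ⟨j, _, rfl⟩
  · have hnew : Sum.elim (fun c : ↥(B ∪ b.entries) => (c : M))
        (fun x : Vr => n (paddedPt (shiftPt h (vc x).1)) (vc x).2) =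
        fun y => n (paddedPt (shiftPt h (code y))) (pl y) := by
      funext y
      rcases y with c | x
      · refine (hc c).symm.trans ?_
        change _ = n (paddedPt (shiftPt h (Sum.map id (midEmb _ I _) (cz c)))) (cx c)
        rcases cz c with z | z <;> rfl
      · rfl
    have h1 : φ.Realize _ := hq hφq
    change φ.Realize _
    rw [hnew]
    rw [horig] at h1
    refine (realize_move hn φ _ _ _ fun y hy z hz => ?_).1 h1
    exact shiftPt_lt_iff hh hge ((hf ⟨φ, hφq⟩ y hy).mono (hj₀ _).le)
      ((hf ⟨φ, hφq⟩ z hz).mono (hj₀ _).le)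

end InFamily

/-! ### Patterns from finite configurations -/

open Classical in
theorem exists_formula_finite_variables {X β : Type*} (φ : L.Formula (X ⊕ β)) :
    ∃ (n : ℕ) (ψ : L.Formula (X ⊕ Fin n)) (e : Fin n → β), ∀ (M : Type u) [L.Structure M]
      (v : X → M) (w : β → M),
      ψ.Realize (Sum.elim v (fun k => w (e k))) ↔ φ.Realize (Sum.elim v w) := by
  let E := φ.freeVarFinset.toRight.equivFin
  let g : φ.freeVarFinset → X ⊕ Fin φ.freeVarFinset.toRight.card := fun z =>
    match z with
    | ⟨Sum.inl x, _⟩ => Sum.inl x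
    | ⟨Sum.inr y, h⟩ => Sum.inr (E ⟨y, Finset.mem_toRight.2 h⟩)
  refine ⟨_, φ.restrictFreeVar g, fun k => (E.symm k : β), fun M _ v w => ?_⟩
  refine Language.BoundedFormula.realize_restrictFreeVar (f := g) (Sum.elim v w) ?_
  rintro ⟨x | y, h⟩
  · rfl
  · simp [g]

/-- Compactness: a finite part of the required set mentions finitely many `i` and finitely many `η`
and `t`, all of whose relevant values lie below some `N`. The parameters `b` must serve all these
`η` at once, so they are chosen before `η`. -/
theorem ictPattern_of_finite {T : L.Theory} {m : ℕ} {ι : Type u} {β : ι → Type u} (hι : #ι = ℵ₀)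
    (φ : ∀ i, L.Formula (Fin m ⊕ β i)) (M : FirstOrder.Language.Theory.ModelType.{u, u, u} T)
    (h : ∀ (F : Finset ι) (N : ℕ), ∃ b : ∀ i, ℕ → β i → M, ∀ η : ι → ℕ, (∀ i ∈ F, η i < N) →
      ∃ d : Fin m → M, ∀ i ∈ F, ∀ t < N, ((φ i).Realize (Sum.elim d (b i t)) ↔ η i = t)) :
    IctPattern T m := by
  classical
  choose n ψ e hψ using fun i => exists_formula_finite_variables (φ i)
  let Λ : Type u := ULift.{u} ℕ
  let V : Type u := ((ι → Λ) × Fin m) ⊕ (Σ i, Λ × Fin (n i))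
  let pat : (ι → Λ) × ι × Λ → L.Formula V := fun x => (ψ x.2.1).relabel
    (Sum.elim (fun j => Sum.inl (x.1, j)) (fun k => Sum.inr ⟨x.2.1, x.2.2, k⟩))
  let Q : (ι → Λ) × ι × Λ → L.Formula V := fun x =>
    if x.1 x.2.1 = x.2.2 then pat x else (pat x).not
  have hQ : ∀ (M : Type u) [L.Structure M] (v : V → M) x, (Q x).Realize v ↔
      ((ψ x.2.1).Realize (Sum.elim (fun j => v (Sum.inl (x.1, j)))
        (fun k => v (Sum.inr ⟨x.2.1, x.2.2, k⟩))) ↔ x.1 x.2.1 = x.2.2) := by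
    intro M _ v x
    have hpat : (pat x).Realize v ↔ (ψ x.2.1).Realize (Sum.elim (fun j => v (Sum.inl (x.1, j)))
        (fun k => v (Sum.inr ⟨x.2.1, x.2.2, k⟩))) := by
      simp only [pat, Language.Formula.realize_relabel]
      refine iff_of_eq (congrArg _ ?_)
      funext z; cases z <;> rfl
    by_cases hx : x.1 x.2.1 = x.2.2
    · simp [Q, hx, hpat]
    · simp [Q, hx, hpat, Language.Formula.realize_not]
  have hsat : Sat T (Set.range Q) := by
    refine sat_range_of_finset fun J => ?_
    let F : Finset ι := J.image (fun x => x.2.1)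
    let N : ℕ := J.sup (fun x => max x.2.2.down (F.sup fun i => (x.1 i).down)) + 1
    obtain ⟨b, hb⟩ := h F N
    have : Nonempty M := inferInstance
    let d : (ι → Λ) → Fin m → M := fun η =>
      if hη : ∀ i ∈ F, (η i).down < N then (hb (fun i => (η i).down) hη).choose
      else fun _ => Classical.arbitrary M
    refine ⟨M, Sum.elim (fun x => d x.1 x.2) (fun x => b x.1 x.2.1.down (e x.1 x.2.2)), ?_⟩
    rintro _ ⟨x, hx, rfl⟩
    rw [hQ]
    have hle := Finset.le_sup (f := fun x : (ι → Λ) × ι × Λ =>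
      max x.2.2.down (F.sup fun i => (x.1 i).down)) hx
    have hη : ∀ i ∈ F, (x.1 i).down < N := fun i hi => Nat.lt_succ_of_le
      (((Finset.le_sup (f := fun i => (x.1 i).down) hi).trans (le_max_right _ _)).trans hle)
    have ht : x.2.2.down < N := Nat.lt_succ_of_le ((le_max_left _ _).trans hle)
    have := (hb (fun i => (x.1 i).down) hη).choose_spec x.2.1 (Finset.mem_image_of_mem _ hx) _ ht
    refine Iff.trans (hψ x.2.1 M (d x.1) (fun y => b x.2.1 x.2.2.down y)) ?_
    simp only [d, dif_pos hη]
    exact this.trans ULift.down_inj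
  obtain ⟨M', v, hv⟩ := hsat
  exact ⟨ι, n, ψ, hι, Λ, inferInstanceAs (Infinite (ULift.{u} ℕ)), M',
    fun η j => v (Sum.inl (η, j)), fun i t k => v (Sum.inr ⟨i, t, k⟩),
    fun η i t => (hQ M' v (η, i, t)).1 (hv _ ⟨(η, i, t), rfl⟩)⟩

/-! ### Combinatorics of finite configurations -/

/-- Pigeonhole: among `2 * c` consecutive integers, one truth value occurs at least `c` times. -/
theorem exists_monochromatic (χ : ℕ → Prop) (a c : ℕ) : ∃ (v : Prop) (e : ℕ → ℕ),
    (∀ i j, i < j → j < c → e i < e j) ∧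
      ∀ i < c, a ≤ e i ∧ e i < a + 2 * c ∧ (χ (e i) ↔ v) := by
  classical
  have key : ∀ (v : Prop) (S : Finset ℕ), (∀ i ∈ S, (a ≤ i ∧ i < a + 2 * c) ∧ (χ i ↔ v)) →
      c ≤ S.card → ∃ e : ℕ → ℕ, (∀ i j, i < j → j < c → e i < e j) ∧
        ∀ i < c, a ≤ e i ∧ e i < a + 2 * c ∧ (χ (e i) ↔ v) := by
    intro v S hS hc
    let o := Finset.orderEmbOfCardLe _ hc
    refine ⟨fun i => if h : i < c then o ⟨i, h⟩ else 0, fun i j hij hj => ?_, fun i hi => ?_⟩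
    · simp only [dif_pos hj, dif_pos (hij.trans hj)]
      exact o.strictMono hij
    · simp only [dif_pos hi]
      have := hS _ (Finset.orderEmbOfCardLe_mem _ hc ⟨i, hi⟩)
      exact ⟨this.1.1, this.1.2, this.2⟩
  have hsum := Finset.card_filter_add_card_filter_not (s := Finset.Ico a (a + 2 * c))
    (fun i => χ i)
  rw [Nat.card_Ico] at hsum
  by_cases h : c ≤ ((Finset.Ico a (a + 2 * c)).filter (fun i => χ i)).card
  · exact ⟨True, key True _ (fun i hi => by simpa using (Finset.mem_filter.1 hi)) h⟩
  · exact ⟨False, key False ((Finset.Ico a (a + 2 * c)).filter (fun i => ¬ χ i))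
      (fun i hi => by simpa using (Finset.mem_filter.1 hi)) (by omega)⟩

/-- A long sequence of truth values changing in the middle has subsequences, made of `N` pairs, such
that exactly one prescribed pair consists of different truth values. -/
theorem exists_single_change (N : ℕ) : ∃ Y m₀ : ℕ, m₀ + 1 < Y ∧ 2 * N ≤ Y ∧ ∀ χ : ℕ → Prop,
    ¬ (χ m₀ ↔ χ (m₀ + 1)) → ∀ t < N, ∃ w : ℕ → ℕ, (∀ i j, i < j → j < 2 * N → w i < w j) ∧
      (∀ i < 2 * N, w i < Y) ∧ ∀ j < N, (¬ (χ (w (2 * j)) ↔ χ (w (2 * j + 1))) ↔ j = t) := by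
  -- The `4 * N` places before `m₀` contain `2 * N` of one value `v`, the `4 * N + 2` places after
  -- `m₀ + 1` contain `2 * N + 1` of one value `v'`. A place `y` with value different from `v`
  -- separates the two: one of `m₀`, `m₀ + 1` if `v' = v`, otherwise `r 0`.
  refine ⟨8 * N + 4, 4 * N, by omega, by omega, fun χ hχ t ht => ?_⟩
  obtain ⟨v, l, hl, hlv⟩ := exists_monochromatic χ 0 (2 * N)
  obtain ⟨v', r, hr, hrv⟩ := exists_monochromatic χ (4 * N + 2) (2 * N + 1)
  obtain ⟨y, hy1, hy2, hyv⟩ : ∃ y, 4 * N ≤ y ∧ (∀ j < 2 * N, 1 ≤ j → y < r j) ∧ ¬ (χ y ↔ v) := by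
    by_cases hvv : v' ↔ v
    · by_cases h0 : χ (4 * N) ↔ v
      · exact ⟨4 * N + 1, by omega, fun j hj _ => by have := hrv j (by omega); omega, by tauto⟩
      · exact ⟨4 * N, by omega, fun j hj _ => by have := hrv j (by omega); omega, h0⟩
    · have h0 := hrv 0 (by omega)
      exact ⟨r 0, by omega, fun j hj h1 => hr 0 j (by omega) (by omega), by tauto⟩
  have hyY : ∀ j < 2 * N, 1 ≤ j → y < 8 * N + 4 := fun j hj h1 => by
    have := hy2 j hj h1
    have := hrv j (by omega)
    omega
  -- Pairs before `t` lie in the left block and pairs after `t` in the right one; only pair `t`,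
  -- made of `l (2 * t)` and `y`, is mixed.
  let w : ℕ → ℕ := fun i => if i ≤ 2 * t then l i else if i = 2 * t + 1 then y else r i
  have w1 : ∀ i, i ≤ 2 * t → w i = l i := fun i hi => if_pos hi
  have w2 : ∀ i, i = 2 * t + 1 → w i = y := fun i hi => by
    simp only [w]
    rw [if_neg (by omega), if_pos hi]
  have w3 : ∀ i, 2 * t + 1 < i → w i = r i := fun i hi => by
    simp only [w]
    rw [if_neg (by omega), if_neg (by omega)]
  refine ⟨w, ?_, ?_, ?_⟩
  · intro i j hij hj
    have hi' := hlv i (by omega)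
    have hj' := hrv j (by omega)
    rcases lt_trichotomy j (2 * t + 1) with h1 | h1 | h1
    · rw [w1 j (by omega), w1 i (by omega)]
      exact hl i j hij hj
    · rw [w2 j h1, w1 i (by omega)]
      omega
    · rw [w3 j h1]
      rcases lt_trichotomy i (2 * t + 1) with h2 | h2 | h2
      · rw [w1 i (by omega)]; omega
      · rw [w2 i h2]; exact hy2 j hj (by omega)
      · rw [w3 i h2]; exact hr i j hij (by omega)
  · intro i hi
    have h1 := hlv i hi
    have h2 := hrv i (by omega)
    have h3 := hyY (2 * t + 1) (by omega) (by omega)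
    rcases lt_trichotomy i (2 * t + 1) with h | h | h
    · rw [w1 i (by omega)]; omega
    · rw [w2 i h]; omega
    · rw [w3 i h]; omega
  · intro j hj
    rcases lt_trichotomy j t with h | h | h
    · rw [w1 _ (by omega), w1 _ (by omega)]
      have h1 := hlv (2 * j) (by omega)
      have h2 := hlv (2 * j + 1) (by omega)
      simpa [h.ne] using h1.2.2.trans h2.2.2.symm
    · rw [w1 _ (by omega), w2 _ (by omega)]
      have h1 := hlv (2 * j) (by omega)
      refine iff_of_true (fun h2 => hyv ?_) h
      exact h2.symm.trans h1.2.2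
    · rw [w3 _ (by omega), w3 _ (by omega)]
      have h1 := hrv (2 * j) (by omega)
      have h2 := hrv (2 * j + 1) (by omega)
      simpa [h.ne'] using h1.2.2.trans h2.2.2.symm

/-- Finite sets embed into infinite linear orders. -/
theorem exists_strictMonoOn {Z I : Type*} [LinearOrder Z] [LinearOrder I] [Infinite I]
    (F : Finset Z) : ∃ G : Z → I, StrictMonoOn G F := by
  classical
  obtain ⟨H, hH⟩ := Infinite.exists_subset_card_eq I F.card
  refine ⟨fun x => if hx : x ∈ F then
    H.orderEmbOfFin hH ((F.orderIsoOfFin rfl).symm ⟨x, hx⟩) else Classical.arbitrary I, ?_⟩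
  intro x hx y hy hxy
  have hx' : x ∈ F := hx
  have hy' : y ∈ F := hy
  simp only [dif_pos hx', dif_pos hy']
  exact (H.orderEmbOfFin hH).strictMono ((F.orderIsoOfFin rfl).symm.strictMono hxy)

/-- A property of increasing tuples which is invariant under moving a single point is constant. -/
theorem iff_of_move_invariant {I : Type*} [LinearOrder I] {J : Set I} {n : ℕ}
    {P : (Fin n → I) → Prop} (hP : ∀ (s : Fin n → I) (k : Fin n) (y : I), StrictMono s →
      (∀ i, s i ∈ J) → y ∈ J → s k < y → StrictMono (Function.update s k y) →
      (P s ↔ P (Function.update s k y))) {s t : Fin n → I} (hs : StrictMono s) (ht : StrictMono t)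
    (hsJ : ∀ i, s i ∈ J) (htJ : ∀ i, t i ∈ J) : P s ↔ P t := by
  classical
  -- If `s ≤ t` pointwise, raising the largest differing coordinate keeps the tuple increasing and
  -- leaves one difference fewer. In general both tuples are compared with their pointwise maximum.
  have main : ∀ (d : ℕ) (s t : Fin n → I), StrictMono s → StrictMono t → (∀ i, s i ∈ J) →
      (∀ i, t i ∈ J) → (∀ i, s i ≤ t i) → (Finset.univ.filter (fun i => s i ≠ t i)).card = d →
      (P s ↔ P t) := by
    intro d
    induction d with
    | zero =>
      intro s t _ _ _ _ _ hd
      have : s = t := by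
        funext i
        by_contra hi
        have : i ∈ Finset.univ.filter (fun i => s i ≠ t i) := by simpa using hi
        rw [Finset.card_eq_zero.1 hd] at this
        simp at this
      rw [this]
    | succ d ih =>
      intro s t hs ht hsJ htJ hle hd
      have hne : (Finset.univ.filter (fun i => s i ≠ t i)).Nonempty :=
        Finset.card_pos.1 (by omega)
      set k := (Finset.univ.filter (fun i => s i ≠ t i)).max' hne with hk
      have hkm : s k ≠ t k := by
        have := Finset.max'_mem _ hne
        rw [Finset.mem_filter] at this
        exact this.2
      have hklt : s k < t k := lt_of_le_of_ne (hle k) hkm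
      have hgt : ∀ j, k < j → s j = t j := by
        intro j hj
        by_contra hne'
        exact absurd (Finset.le_max' _ j (by simpa using hne')) (not_le.2 hj)
      have hmono : StrictMono (Function.update s k (t k)) := by
        intro i j hij
        by_cases hi : i = k
        · subst hi
          rw [Function.update_self, Function.update_of_ne hij.ne', hgt j hij]
          exact ht hij
        · rw [Function.update_of_ne hi]
          by_cases hj : j = k
          · rw [hj, Function.update_self]
            rw [hj] at hij
            exact (hs hij).trans hklt
          · rw [Function.update_of_ne hj]; exact hs hij
      rw [hP s k (t k) hs hsJ (htJ k) hklt hmono]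
      refine ih _ t hmono ht (fun i => ?_) htJ (fun i => ?_) ?_
      · by_cases hi : i = k
        · rw [hi, Function.update_self]; exact htJ k
        · rw [Function.update_of_ne hi]; exact hsJ i
      · by_cases hi : i = k
        · rw [hi, Function.update_self]
        · rw [Function.update_of_ne hi]; exact hle i
      · have : Finset.univ.filter (fun i => Function.update s k (t k) i ≠ t i) =
            (Finset.univ.filter (fun i => s i ≠ t i)).erase k := by
          ext i
          by_cases hi : i = k
          · simp [hi]
          · simp [hi]
        rw [this, Finset.card_erase_of_mem (Finset.max'_mem _ hne), hd]
        rfl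
  have hmax : StrictMono (fun i => max (s i) (t i)) := fun i j hij =>
    max_lt_max (hs hij) (ht hij)
  have hmaxJ : ∀ i, max (s i) (t i) ∈ J := fun i => by
    rcases max_choice (s i) (t i) with h | h <;> rw [h]
    exacts [hsJ i, htJ i]
  exact (main _ s _ hs hmax hsJ hmaxJ (fun i => le_max_left _ _) rfl).trans
    (main _ t _ ht hmax htJ hmaxJ (fun i => le_max_right _ _) rfl).symm

/-! ### Convex partitions and separated bad sets -/

section Split

variable {I : Type*} [LinearOrder I]

/-- `J` is partitioned into finitely many convex subsets satisfying `G`. -/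
def FinitelyGood (G : Set I → Prop) (J : Set I) : Prop :=
  ∃ (N : ℕ) (f : I → ℕ), MonotoneOn f J ∧ (∀ t ∈ J, f t < N) ∧ ∀ k, G {t | t ∈ J ∧ f t = k}

/-- `J` and `J'` lie on different sides of a cut. -/
def Separated (J J' : Set I) : Prop :=
  (∀ x ∈ J, ∀ y ∈ J', x < y) ∨ ∀ x ∈ J, ∀ y ∈ J', y < x

variable {G : Set I → Prop}

theorem FinitelyGood.of_good (hmono : ∀ J J', J ⊆ J' → G J' → G J) {J : Set I} (h : G J) :
    FinitelyGood G J :=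
  ⟨1, fun _ => 0, fun _ _ _ _ _ => le_rfl, fun _ _ => Nat.one_pos,
    fun _ => hmono _ _ (fun _ hx => hx.1) h⟩

theorem FinitelyGood.union (hmono : ∀ J J', J ⊆ J' → G J' → G J) {J J' : Set I}
    (hlt : ∀ x ∈ J, ∀ y ∈ J', x < y) (h : FinitelyGood G J) (h' : FinitelyGood G J') :
    FinitelyGood G (J ∪ J') := by
  classical
  obtain ⟨N, f, hf, hN, hG⟩ := h
  obtain ⟨N', f', hf', hN', hG'⟩ := h'
  have hdis : ∀ x ∈ J', x ∉ J := fun x hx hx' => (hlt x hx' x hx).false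
  refine ⟨N + N', fun t => if t ∈ J then f t else N + f' t, ?_, ?_, fun k => ?_⟩
  · rintro x (hx | hx) y (hy | hy) hxy
    · simpa [hx, hy] using hf hx hy hxy
    · simp only [hx, hdis y hy, if_true, if_false]
      exact (hN x hx).le.trans (Nat.le_add_right _ _)
    · exact absurd (hlt y hy x hx) (not_lt.2 hxy)
    · simpa [hdis x hx, hdis y hy] using hf' hx hy hxy
  · rintro x (hx | hx)
    · simp only [hx, if_true]; exact (hN x hx).trans_le (Nat.le_add_right _ _)
    · simpa [hdis x hx] using hN' x hx
  · by_cases hk : k < N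
    · refine hmono _ _ ?_ (hG k)
      rintro x ⟨hx | hx, hxk⟩
      · exact ⟨hx, by simpa [hx] using hxk⟩
      · simp only [hdis x hx, if_false] at hxk; omega
    · refine hmono _ _ ?_ (hG' (k - N))
      rintro x ⟨hx | hx, hxk⟩
      · simp only [hx, if_true] at hxk
        have := hN x hx; omega
      · simp only [hdis x hx, if_false] at hxk
        exact ⟨hx, by omega⟩

/-- `U` collects the points whose initial segment in `J` is good; by finite character `U` is good,
so the rest `V` is bad. If some `t ∈ V` leaves a bad tail of `V` above it, cut after `t`. Otherwise
these tails are all finitely good; a point `t` whose closed final segment in `V` is not good exists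
by the same argument, and what lies below it in `V` must be bad. -/
theorem exists_split (hmono : ∀ J J', J ⊆ J' → G J' → G J)
    (hfin : ∀ J : Set I, (∀ F : Finset I, (F : Set I) ⊆ J → G F) → G J) (hsub : ∀ x, G {x})
    (hempty : G ∅) {J : Set I} (hJ : ¬ FinitelyGood G J) :
    ∃ D J' : Set I, D ⊆ J ∧ J' ⊆ J ∧ ¬ G D ∧ ¬ FinitelyGood G J' ∧ Separated D J' := by
  set U : Set I := {t | t ∈ J ∧ G {s | s ∈ J ∧ s ≤ t}} with hU
  have hGU : G U := by
    refine hfin _ fun F hF => ?_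
    rcases F.eq_empty_or_nonempty with rfl | hne
    · simpa using hempty
    · exact hmono _ {s | s ∈ J ∧ s ≤ F.max' hne} (fun x hx => ⟨(hF hx).1, F.le_max' x hx⟩)
        (hF (F.max'_mem hne)).2
  set V : Set I := {t | t ∈ J ∧ t ∉ U} with hV
  have hUV : ∀ x ∈ U, ∀ y ∈ V, x < y := by
    intro x hx y hy
    by_contra hle
    exact hy.2 ⟨hy.1, hmono _ {s | s ∈ J ∧ s ≤ x}
      (fun s hs => ⟨hs.1, hs.2.trans (not_lt.1 hle)⟩) hx.2⟩
  have hVbad : ¬ FinitelyGood G V := fun hVg => hJ (by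
    have h := FinitelyGood.union hmono hUV (FinitelyGood.of_good hmono hGU) hVg
    have : U ∪ V = J := by
      ext x
      by_cases hx : x ∈ U
      · simp [hx, hx.1]
      · simp [hV, hx]
    rwa [this] at h)
  by_cases hcase : ∃ t ∈ V, ¬ FinitelyGood G {s | s ∈ V ∧ t < s}
  · obtain ⟨t, ht, hbad⟩ := hcase
    exact ⟨{s | s ∈ J ∧ s ≤ t}, _, fun s hs => hs.1, fun s hs => hs.1.1,
      fun hg => ht.2 ⟨ht.1, hg⟩, hbad, Or.inl fun x hx y hy => hx.2.trans_lt hy.2⟩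
  · push Not at hcase
    set U' : Set I := {t | t ∈ V ∧ G {s | s ∈ V ∧ t ≤ s}} with hU'
    have hGU' : G U' := by
      refine hfin _ fun F hF => ?_
      rcases F.eq_empty_or_nonempty with rfl | hne
      · simpa using hempty
      · exact hmono _ {s | s ∈ V ∧ F.min' hne ≤ s} (fun x hx => ⟨(hF hx).1, F.min'_le x hx⟩)
          (hF (F.min'_mem hne)).2
    obtain ⟨t, htV, htU⟩ : ∃ t ∈ V, t ∉ U' := by
      by_contra! hsubset
      exact hVbad (FinitelyGood.of_good hmono (hmono _ _ hsubset hGU'))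
    refine ⟨{s | s ∈ V ∧ t ≤ s}, {s | s ∈ V ∧ s < t}, fun s hs => hs.1.1, fun s hs => hs.1.1,
      fun hg => htU ⟨htV, hg⟩, fun hg => hVbad ?_, Or.inr fun x hx y hy => hy.2.trans_le hx.2⟩
    have h1 := FinitelyGood.union hmono (J := {s | s ∈ V ∧ s < t}) (J' := {t})
      (fun x hx y hy => by rw [Set.mem_singleton_iff.1 hy]; exact hx.2) hg
      (FinitelyGood.of_good hmono (hsub t))
    have h2 := FinitelyGood.union hmono (J' := {s | s ∈ V ∧ t < s}) (by
      rintro x (hx | hx) y hy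
      · exact hx.2.trans hy.2
      · rw [Set.mem_singleton_iff.1 hx]; exact hy.2) h1 (hcase t htV)
    have : ({s | s ∈ V ∧ s < t} ∪ {t}) ∪ {s | s ∈ V ∧ t < s} = V := by
      ext x
      rcases lt_trichotomy x t with h | h | h
      · simp [h, h.not_gt, h.ne]
      · simp [h, htV]
      · simp [h, h.not_gt, h.ne']
    rwa [this] at h2

/-- If `I` is not a finite union of convex sets satisfying `G`, then there is an infinite family of
separated sets not satisfying `G`. -/
theorem exists_separated_family (hmono : ∀ J J', J ⊆ J' → G J' → G J)
    (hfin : ∀ J : Set I, (∀ F : Finset I, (F : Set I) ⊆ J → G F) → G J) (hsub : ∀ x, G {x})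
    (hempty : G ∅) {J : Set I} (hJ : ¬ FinitelyGood G J) :
    ∃ (R : Set I) (D : R → Set I), #R = ℵ₀ ∧ (∀ r, D r ⊆ J) ∧ (∀ r, ¬ G (D r)) ∧
      ∀ r r', r < r' → ∀ x ∈ D r, ∀ y ∈ D r', x < y := by
  choose! D J' hD hJ' hGD hbad hsep using
    fun (J : Set I) (hJ : ¬ FinitelyGood G J) => exists_split hmono hfin hsub hempty hJ
  -- Iterated splitting gives a decreasing sequence of bad sets; each `D (A l)` lies inside the part
  -- set aside when `D (A k)` was split off, for `k < l`.
  let A : ℕ → Set I := fun k => J'^[k] J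
  have hA : ∀ k, ¬ FinitelyGood G (A k) := by
    intro k
    induction k with
    | zero => exact hJ
    | succ k ih => simp only [A, Function.iterate_succ_apply'] at ih ⊢; exact hbad _ ih
  have hAs : ∀ k, A (k + 1) = J' (A k) := fun k => by simp [A, Function.iterate_succ_apply']
  have hanti : Antitone A := antitone_nat_of_succ_le fun k => by
    rw [hAs]; exact hJ' _ (hA k)
  have hsep' : ∀ k l, k < l → Separated (D (A k)) (D (A l)) := by
    intro k l hkl
    have hsubs : D (A l) ⊆ J' (A k) := by
      rw [← hAs]
      exact (hD _ (hA l)).trans (hanti hkl)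
    rcases hsep _ (hA k) with h | h
    · exact Or.inl fun x hx y hy => h x hx y (hsubs hy)
    · exact Or.inr fun x hx y hy => h x hx y (hsubs hy)
  have hne : ∀ k, (D (A k)).Nonempty := fun k => by
    rw [Set.nonempty_iff_ne_empty]
    exact fun h => hGD _ (hA k) (h ▸ hempty)
  -- A representative of each set serves as its index: the order of the representatives decides on
  -- which side of the cut each set lies.
  choose r hr using hne
  have hrne : ∀ k l, k < l → r k ≠ r l := by
    intro k l hkl h
    rcases hsep' k l hkl with h' | h'
    · exact (h' _ (hr k) _ (hr l)).ne h
    · exact (h' _ (hr k) _ (hr l)).ne h.symm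
  have hinj : Function.Injective r := by
    intro k l h
    rcases lt_trichotomy k l with hkl | hkl | hkl
    · exact absurd h (hrne _ _ hkl)
    · exact hkl
    · exact absurd h.symm (hrne _ _ hkl)
  have hidx : ∀ x : Set.range r, ∃ k, r k = x := fun x => x.2
  choose q hq using hidx
  refine ⟨Set.range r, fun x => D (A (q x)), ?_, fun x => (hD _ (hA _)).trans
    (hanti (Nat.zero_le _)), fun x => hGD _ (hA _), fun x y hxy => ?_⟩
  · have h1 : #(Set.range r) ≤ ℵ₀ := Cardinal.mk_le_aleph0_iff.2 (Set.countable_range r).to_subtype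
    have : Infinite (Set.range r) := Set.infinite_coe_iff.2 (Set.infinite_range_of_injective hinj)
    exact le_antisymm h1 (Cardinal.aleph0_le_mk _)
  · have hlt : r (q x) < r (q y) := by rw [hq, hq]; exact hxy
    have hqne : q x ≠ q y := fun h => hlt.ne (congrArg r h)
    rcases lt_or_gt_of_ne hqne with h | h
    · rcases hsep' _ _ h with h' | h'
      · exact h'
      · exact absurd (h' _ (hr _) _ (hr _)) hlt.not_gt
    · rcases hsep' _ _ h with h' | h'
      · exact absurd (h' _ (hr _) _ (hr _)) hlt.not_gt
      · exact fun a ha b hb => h' b hb a ha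

end Split

/-! ### Dividing configurations give patterns -/

/-- The formula `¬ (φ(x, u) ↔ φ(x, v))`. -/
noncomputable def changeFormula {X B : Type*} (φ : L.Formula (X ⊕ B)) : L.Formula (X ⊕ (B ⊕ B)) :=
  ((φ.relabel (Sum.map id Sum.inl)).iff (φ.relabel (Sum.map id Sum.inr))).not

theorem realize_changeFormula {M : Type u} [L.Structure M] {X B : Type*} (φ : L.Formula (X ⊕ B))
    (v : X → M) (w w' : B → M) : (changeFormula φ).Realize (Sum.elim v (Sum.elim w w')) ↔
      ¬ (φ.Realize (Sum.elim v w) ↔ φ.Realize (Sum.elim v w')) := by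
  rw [changeFormula, Language.Formula.realize_not, Language.Formula.realize_iff,
    realize_sum_relabel, realize_sum_relabel]
  rfl

/-- Room for the rearrangements: a block for each `r`, in it a slot for each coordinate `i`, and `Y`
positions in each slot. -/
theorem exists_lex_family (R I : Type*) [LinearOrder R] [LinearOrder I] [Infinite I]
    (F : Finset R) (A Y : ℕ) : ∃ G : R → ℕ → ℕ → I, ∀ r ∈ F, ∀ r' ∈ F, ∀ i < A, ∀ i' < A,
      ∀ y < Y, ∀ y' < Y, (G r i y < G r' i' y' ↔ r < r' ∨ r = r' ∧ (i < i' ∨ i = i' ∧ y < y')) := by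
  classical
  obtain ⟨G, hG⟩ := exists_strictMonoOn (Z := R ×ₗ (ℕ ×ₗ ℕ)) (I := I)
    ((F ×ˢ (Finset.range A ×ˢ Finset.range Y)).image fun x => toLex (x.1, toLex x.2))
  have hmem : ∀ r ∈ F, ∀ i < A, ∀ y < Y, toLex (r, toLex (i, y)) ∈
      (((F ×ˢ (Finset.range A ×ˢ Finset.range Y)).image fun x => toLex (x.1, toLex x.2) :
        Finset (R ×ₗ (ℕ ×ₗ ℕ))) : Set (R ×ₗ (ℕ ×ₗ ℕ))) := by
    intro r hr i hi y hy
    rw [Finset.mem_coe, Finset.mem_image]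
    exact ⟨(r, i, y), by simp [hr, hi, hy], rfl⟩
  refine ⟨fun r i y => G (toLex (r, toLex (i, y))), fun r hr r' hr' i hi i' hi' y hy y' hy' => ?_⟩
  rw [hG.lt_iff_lt (hmem r hr i hi y hy) (hmem r' hr' i' hi' y' hy'), Prod.Lex.toLex_lt_toLex,
    Prod.Lex.toLex_lt_toLex]

section

variable {M : Type u} [L.Structure M] [Nonempty M] {I α R : Type u} [LinearOrder I] [Infinite I]
  [LinearOrder R] {X : Type*}

open Classical in
-- Two moves of the indiscernible sequence. The first places the tuples in lexicographic blocks,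
-- with the moving coordinate at positions `m₀` and `m₀ + 1` of its slot. By `exists_single_change`
-- one can select in this slot `N` pairs of positions of which only pair `η r` shows a change. The
-- second move carries the selected positions to `0, …, 2 * N - 1`, so that the parameters no longer
-- depend on `η`; only `d` does.
theorem exists_finite_configuration {a : I → α → M} (ha : IndiscernibleOver L (∅ : Set M) a)
    (c : X → M) {n : R → ℕ} (φ : ∀ r, L.Formula (X ⊕ (Fin (n r) × α)))
    (s : ∀ r, Fin (n r) → I) (k : ∀ r, Fin (n r)) (y : R → I) (D : R → Set I)
    (hsD : ∀ r i, s r i ∈ D r) (hyD : ∀ r, y r ∈ D r)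
    (hD : ∀ r r', r < r' → ∀ x ∈ D r, ∀ x' ∈ D r', x < x')
    (hs : ∀ r, StrictMono (s r)) (hy : ∀ r, s r (k r) < y r)
    (hupd : ∀ r, StrictMono (Function.update (s r) (k r) (y r)))
    (hφ : ∀ r, ¬ ((φ r).Realize (Sum.elim c fun p => a (s r p.1) p.2) ↔
      (φ r).Realize (Sum.elim c fun p => a (Function.update (s r) (k r) (y r) p.1) p.2)))
    (F : Finset R) (N : ℕ) :
    ∃ b : ∀ r, ℕ → ((Fin (n r) × α) ⊕ (Fin (n r) × α)) → M, ∀ η : R → ℕ, (∀ r ∈ F, η r < N) →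
      ∃ d : X → M, ∀ r ∈ F, ∀ t < N,
        ((changeFormula (φ r)).Realize (Sum.elim d (b r t)) ↔ η r = t) := by
  obtain ⟨Y, m₀, hm₀, hNY, hchange⟩ := exists_single_change N
  have hA : ∀ r ∈ F, ∀ i : Fin (n r), (i : ℕ) < F.sup n := fun r hr i =>
    i.2.trans_le (Finset.le_sup (f := n) hr)
  obtain ⟨G, hG⟩ := exists_lex_family R I F (F.sup n) Y
  -- all the points `s r i` and `y r` are moved into the image of `G`
  let f₁ : (Σ r : F, Option (Fin (n r))) → I := fun x => x.2.elim (y x.1) (s x.1)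
  let p₁ : (Σ r : F, Option (Fin (n r))) → ℕ × ℕ := fun x =>
    x.2.elim (((k x.1 : Fin _) : ℕ), m₀ + 1) (fun i => ((i : ℕ), m₀))
  have h₁ : ∀ x x', f₁ x < f₁ x' ↔ G x.1 (p₁ x).1 (p₁ x).2 < G x'.1 (p₁ x').1 (p₁ x').2 := by
    have hp1 : ∀ x, (p₁ x).1 < F.sup n := by
      rintro ⟨r, _ | i⟩
      exacts [hA r r.2 (k r), hA r r.2 i]
    have hp2 : ∀ x, (p₁ x).2 < Y := by
      rintro ⟨r, _ | i⟩
      exacts [hm₀, (Nat.lt_succ_self _).trans hm₀]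
    have hfD : ∀ x, f₁ x ∈ D x.1 := by
      rintro ⟨r, _ | i⟩
      exacts [hyD r, hsD r i]
    intro x x'
    rw [hG _ x.1.2 _ x'.1.2 _ (hp1 x) _ (hp1 x') _ (hp2 x) _ (hp2 x')]
    obtain ⟨r, z⟩ := x
    obtain ⟨r', z'⟩ := x'
    rcases lt_trichotomy (r : R) r' with h | h | h
    · exact iff_of_true (hD _ _ h _ (hfD ⟨r, z⟩) _ (hfD ⟨r', z'⟩)) (Or.inl h)
    · obtain rfl : r = r' := Subtype.ext h
      -- Since the updated tuple is increasing, `y r` lies strictly between the coordinate `k r` of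
      -- `s r` and the next one, matching position `m₀ + 1` of slot `k r`.
      have hlt : ∀ i, s r i < y r ↔ i ≤ k r := by
        intro i
        refine ⟨fun hi => not_lt.1 fun hki => ?_, fun hi => ((hs r).monotone hi).trans_lt (hy r)⟩
        have := hupd r hki
        rw [Function.update_self, Function.update_of_ne hki.ne'] at this
        exact lt_asymm this hi
      have hgt : ∀ i, y r < s r i ↔ k r < i := by
        intro i
        refine ⟨fun hi => (hs r).lt_iff_lt.1 ((hy r).trans hi), fun hi => ?_⟩
        have := hupd r hi
        rwa [Function.update_self, Function.update_of_ne hi.ne'] at this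
      rcases z with _ | i <;> rcases z' with _ | j
      · simp [f₁]
      · simp [f₁, p₁, hgt]
      · simp only [f₁, p₁, Option.elim, hlt, lt_irrefl, true_and, false_or,
          Nat.lt_succ_self, and_true, Fin.le_def]
        omega
      · simp [f₁, p₁, (hs r).lt_iff_lt]
    · refine iff_of_false (lt_asymm (hD _ _ h _ (hfD ⟨r', z'⟩) _ (hfD ⟨r, z⟩))) ?_
      rintro (h' | h')
      · exact lt_asymm h h'
      · exact h.ne' h'.1
  let g₁ : Bool → ∀ r : F, (Fin (n r) × α) → (Σ r : F, Option (Fin (n r))) × α := fun e r p =>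
    (⟨r, if e = true ∧ p.1 = k r then none else some p.1⟩, p.2)
  obtain ⟨d₁, hd₁⟩ := exists_move ha (fun x => f₁ x.1)
    (fun x => G x.1.1 (p₁ x.1).1 (p₁ x.1).2) (fun x => x.2) (fun x x' => h₁ x.1 x'.1)
    (Δ := Set.range fun q : Bool × F => (φ q.2).relabel (Sum.map id (g₁ q.1 q.2)))
    (Set.finite_range _) c
  -- The truth value of `φ r` as a function of the position of the moving coordinate, the others
  -- staying at `m₀`.
  let χ : R → ℕ → Prop := fun r z => (φ r).Realize
    (Sum.elim d₁ fun p => a (G r p.1 (if p.1 = k r then z else m₀)) p.2)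
  have hχ : ∀ r ∈ F, ¬ (χ r m₀ ↔ χ r (m₀ + 1)) := by
    intro r hr
    have e1 := hd₁ _ ⟨(false, ⟨r, hr⟩), rfl⟩
    have e2 := hd₁ _ ⟨(true, ⟨r, hr⟩), rfl⟩
    simp only [realize_sum_relabel] at e1 e2
    convert hφ r using 2
    · convert e1 using 2
      · congr! 3 with p
        simp [g₁, p₁]
      · congr! 3 with p
    · convert e2 using 2
      · congr! 3 with p
        by_cases hp : p.1 = k r <;> simp [g₁, p₁, hp]
      · congr! 3 with p
        by_cases hp : p.1 = k r <;> simp [g₁, f₁, hp, Function.update_of_ne]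
  refine ⟨fun r t => Sum.elim (fun p => a (G r p.1 (if p.1 = k r then 2 * t else 0)) p.2)
    (fun p => a (G r p.1 (if p.1 = k r then 2 * t + 1 else 0)) p.2), fun η hη => ?_⟩
  choose! w hw1 hw2 hw3 using fun r (hr : r ∈ F) => hchange (χ r) (hχ r hr) (η r) (hη r hr)
  let W := Σ r : F, Fin (n r) × Fin (2 * N)
  let u₁ : W → ℕ := fun x => if x.2.1 = k x.1 then w x.1 x.2.2 else m₀
  let u₂ : W → ℕ := fun x => if x.2.1 = k x.1 then x.2.2 else 0
  have hu₁ : ∀ x, u₁ x < Y := fun x => by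
    by_cases hx : x.2.1 = k x.1
    · simpa only [u₁, if_pos hx] using hw2 _ x.1.2 _ x.2.2.2
    · simp only [u₁, if_neg hx]; omega
  have hu₂ : ∀ x, u₂ x < Y := fun x => by
    by_cases hx : x.2.1 = k x.1
    · simpa only [u₂, if_pos hx] using x.2.2.2.trans_le hNY
    · simp only [u₂, if_neg hx]; omega
  -- `w r` is increasing on indices below `2 * N`, so relabelling position `w r j` as `j`, and `m₀`
  -- as `0` in the other slots, preserves the order.
  have h₂ : ∀ x x' : W, G x.1 x.2.1 (u₁ x) < G x'.1 x'.2.1 (u₁ x') ↔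
      G x.1 x.2.1 (u₂ x) < G x'.1 x'.2.1 (u₂ x') := by
    intro x x'
    rw [hG _ x.1.2 _ x'.1.2 _ (hA _ x.1.2 x.2.1) _ (hA _ x'.1.2 x'.2.1) _ (hu₁ x) _ (hu₁ x'),
      hG _ x.1.2 _ x'.1.2 _ (hA _ x.1.2 x.2.1) _ (hA _ x'.1.2 x'.2.1) _ (hu₂ x) _ (hu₂ x')]
    refine or_congr_right (and_congr_right fun hr => or_congr_right (and_congr_right fun hi => ?_))
    obtain ⟨r, i, j⟩ := x
    obtain ⟨r', i', j'⟩ := x'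
    obtain rfl : r = r' := Subtype.ext hr
    obtain rfl : i = i' := Fin.ext hi
    have hmono : StrictMonoOn (w r) (Set.Iio (2 * N)) := fun z _ z' hz' hzz =>
      hw1 r r.2 z z' hzz hz'
    by_cases hik : i = k r
    · simp only [u₁, u₂, if_pos hik]
      exact hmono.lt_iff_lt j.2 j'.2
    · simp [u₁, u₂, hik]
  let g₂ : ∀ (r : F) (_ : Fin (2 * N)), (Fin (n r) × α) → W × α := fun r j p =>
    (⟨r, p.1, j⟩, p.2)
  obtain ⟨d, hd⟩ := exists_move ha (fun x => G x.1.1 x.1.2.1 (u₁ x.1))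
    (fun x => G x.1.1 x.1.2.1 (u₂ x.1)) (fun x => x.2) (fun x x' => h₂ x.1 x'.1)
    (Δ := Set.range fun q : F × Fin (2 * N) => (φ q.1).relabel (Sum.map id (g₂ q.1 q.2)))
    (Set.finite_range _) d₁
  have hd' : ∀ r ∈ F, ∀ j < 2 * N, ((φ r).Realize
      (Sum.elim d fun p => a (G r p.1 (if p.1 = k r then j else 0)) p.2) ↔ χ r (w r j)) := by
    intro r hr j hj
    have := hd _ ⟨(⟨r, hr⟩, ⟨j, hj⟩), rfl⟩
    simp only [realize_sum_relabel] at this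
    exact this
  refine ⟨d, fun r hr t ht => ?_⟩
  rw [realize_changeFormula, hd' r hr _ (by omega), hd' r hr _ (by omega), hw3 r hr t ht, eq_comm]

end

/-! ### Cutting indiscernible sequences -/

section

variable {M : Type u} [L.Structure M] {I α : Type u} [LinearOrder I] {X : Type*}

/-- The restriction of the sequence `a` to `J` is indiscernible over the tuple `c`. -/
def GoodOn (a : I → α → M) (c : X → M) (J : Set I) : Prop :=
  ∀ (n : ℕ) (φ : L.Formula (X ⊕ (Fin n × α))) (s t : Fin n → I), StrictMono s → StrictMono t →
    (∀ i, s i ∈ J) → (∀ i, t i ∈ J) → (φ.Realize (Sum.elim c fun p => a (s p.1) p.2) ↔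
      φ.Realize (Sum.elim c fun p => a (t p.1) p.2))

theorem GoodOn.mono {a : I → α → M} {c : X → M} {J J' : Set I} (h : J ⊆ J')
    (h' : GoodOn (L := L) a c J') : GoodOn (L := L) a c J :=
  fun n φ s t hs ht hsJ htJ => h' n φ s t hs ht (fun i => h (hsJ i)) (fun i => h (htJ i))

theorem goodOn_of_finset {a : I → α → M} {c : X → M} {J : Set I}
    (h : ∀ F : Finset I, (F : Set I) ⊆ J → GoodOn (L := L) a c F) : GoodOn (L := L) a c J := by
  classical
  intro n φ s t hs ht hsJ htJ
  refine h (Finset.univ.image s ∪ Finset.univ.image t) ?_ n φ s t hs ht (by simp) (by simp)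
  intro x hx
  simp only [Finset.coe_union, Finset.coe_image, Finset.coe_univ, Set.image_univ,
    Set.mem_union, Set.mem_range] at hx
  rcases hx with ⟨i, rfl⟩ | ⟨i, rfl⟩
  exacts [hsJ i, htJ i]

theorem goodOn_of_subsingleton (a : I → α → M) (c : X → M) {J : Set I} (hJ : J.Subsingleton) :
    GoodOn (L := L) a c J := by
  intro n φ s t hs ht hsJ htJ
  rw [show s = t from funext fun i => hJ (hsJ i) (htJ i)]

end

/-- Otherwise infinitely many separated sets fail to be indiscernible over `c`. On each of them some
formula is changed by moving one point, since invariance under such moves would give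
indiscernibility; the changes assemble to a pattern. -/
theorem finitelyGood_goodOn {T : L.Theory} {m : ℕ} (hT : ¬ IctPattern T m)
    (M : FirstOrder.Language.Theory.ModelType.{u, u, u} T) {I α : Type u} [LinearOrder I]
    {a : I → α → M} (ha : IndiscernibleOver L (∅ : Set M) a) (c : Fin m → M) :
    FinitelyGood (GoodOn (L := L) a c) Set.univ := by
  classical
  by_contra hbad
  obtain ⟨R, D, hR, -, hD, hsep⟩ := exists_separated_family (fun _ _ => GoodOn.mono)
    (fun _ => goodOn_of_finset) (fun x => goodOn_of_subsingleton a c Set.subsingleton_singleton)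
    (goodOn_of_subsingleton a c Set.subsingleton_empty) hbad
  have hmove : ∀ r, ∃ (n : ℕ) (φ : L.Formula (Fin m ⊕ (Fin n × α))) (s : Fin n → I) (k : Fin n)
      (y : I), StrictMono s ∧ (∀ i, s i ∈ D r) ∧ y ∈ D r ∧ s k < y ∧
        StrictMono (Function.update s k y) ∧
        ¬ (φ.Realize (Sum.elim c fun p => a (s p.1) p.2) ↔
          φ.Realize (Sum.elim c fun p => a (Function.update s k y p.1) p.2)) := by
    intro r
    by_contra! hno
    refine hD r fun n φ s t hs ht hsJ htJ => ?_
    exact iff_of_move_invariant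
      (P := fun s => φ.Realize (Sum.elim c fun p : Fin n × α => a (s p.1) p.2))
      (fun s k y hs hsD hyD hlt hu => by simpa using hno n φ s k y hs hsD hyD hlt hu) hs ht hsJ htJ
  choose n φ s k y hs hsD hyD hlt hupd hφ using hmove
  have hinfR : Infinite R := Cardinal.infinite_iff.2 hR.ge
  have : Infinite I := Infinite.of_injective _ (Subtype.val_injective (p := fun x => x ∈ R))
  exact hT (ictPattern_of_finite hR (fun r => changeFormula (φ r)) M fun F N =>
    exists_finite_configuration ha c φ s k y D hsD hyD hsep hs hlt hupd
      (fun r => by convert hφ r) F N)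

/-! ### From elements to finite tuples -/

section

variable {I : Type*} [LinearOrder I] {G G' : Set I → Prop}

theorem FinitelyGood.bind (hmono : ∀ J J', J ⊆ J' → G J' → G J) (hempty : G ∅) {J : Set I}
    (h : FinitelyGood G' J) (h' : ∀ J' ⊆ J, G' J' → FinitelyGood G J') : FinitelyGood G J := by
  obtain ⟨N, f, hf, hN, hG⟩ := h
  have key : ∀ k, FinitelyGood G {t | t ∈ J ∧ f t < k} := by
    intro k
    induction k with
    | zero => simpa using FinitelyGood.of_good hmono hempty
    | succ k ih =>
      have h1 := FinitelyGood.union hmono (J' := {t | t ∈ J ∧ f t = k}) (fun x hx y hy => by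
        by_contra hxy
        have h2 := hf hy.1 hx.1 (not_lt.1 hxy)
        have h3 := hx.2
        have h4 := hy.2
        omega) ih (h' _ (fun t ht => ht.1) (hG k))
      convert h1 using 1
      ext t
      simp only [Set.mem_ofPred_eq, Set.mem_union, ← and_or_left, Nat.lt_succ_iff_lt_or_eq]
  convert key N using 1
  ext t
  simpa using hN t

theorem FinitelyGood.of_subtype (hmono : ∀ J J', J ⊆ J' → G J' → G J) {J : Set I}
    (h : FinitelyGood (fun S : Set J => G (Subtype.val '' S)) Set.univ) : FinitelyGood G J := by
  classical
  obtain ⟨N, f, hf, hN, hG⟩ := h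
  refine ⟨N, fun t => if ht : t ∈ J then f ⟨t, ht⟩ else 0, fun t ht t' ht' hle => ?_,
    fun t ht => ?_, fun k => hmono _ _ ?_ (hG k)⟩
  · simp only [dif_pos ht, dif_pos ht']
    exact hf (Set.mem_univ _) (Set.mem_univ _) hle
  · simp only [dif_pos ht]
    exact hN _ (Set.mem_univ _)
  · rintro t ⟨ht, hk⟩
    simp only [dif_pos ht] at hk
    exact ⟨⟨t, ht⟩, ⟨Set.mem_univ _, hk⟩, rfl⟩

end

/-- Induction on the length of `c`. On a piece that is indiscernible over the first `m` entries,
appending these to every term leaves a sequence indiscernible over `∅`, which is cut further by the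
last entry. -/
theorem finitelyGood_goodOn_tuple {T : L.Theory} (hT : ¬ IctPattern T 1)
    (M : FirstOrder.Language.Theory.ModelType.{u, u, u} T) {I α : Type u} [LinearOrder I]
    {a : I → α → M} (ha : IndiscernibleOver L (∅ : Set M) a) (m : ℕ) (c : Fin m → M) :
    FinitelyGood (GoodOn (L := L) a c) Set.univ := by
  induction m with
  | zero =>
    refine FinitelyGood.of_good (fun _ _ => GoodOn.mono) fun n φ s t hs ht _ _ => ?_
    have := indiscernibleOver_empty_realize ha (OrderEmbedding.ofStrictMono s hs)
      (OrderEmbedding.ofStrictMono t ht) (φ.relabel (Sum.elim (fun j : Fin 0 => j.elim0) id))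
    simp only [Language.Formula.realize_relabel] at this
    convert this using 2 <;>
    · funext z
      rcases z with j | p
      · exact j.elim0
      · rfl
  | succ m ih =>
    refine FinitelyGood.bind (fun _ _ => GoodOn.mono)
      (goodOn_of_subsingleton a c Set.subsingleton_empty) (ih fun j => c j.castSucc) ?_
    intro J _ hJ
    refine FinitelyGood.of_subtype (fun _ _ => GoodOn.mono) ?_
    let a' : J → (α ⊕ ULift.{u} (Fin m)) → M := fun t =>
      Sum.elim (a t) (fun j => c j.down.castSucc)
    have ha' : IndiscernibleOver L (∅ : Set M) a' := by
      intro n s t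
      ext φ
      let g : (∅ : Set M) ⊕ (Fin n × (α ⊕ ULift.{u} (Fin m))) → Fin m ⊕ (Fin n × α) :=
        Sum.elim (fun z => z.2.elim)
          (fun p => p.2.elim (fun x => Sum.inr (p.1, x)) (fun j => Sum.inl j.down))
      have h := hJ n (φ.relabel g) (fun i => s i) (fun i => t i) (fun i j hij => s.strictMono hij)
        (fun i j hij => t.strictMono hij) (fun i => (s i).2) (fun i => (t i).2)
      simp only [Language.Formula.realize_relabel] at h
      have hg : ∀ s : Fin n → J, (Sum.elim (fun j : Fin m => c j.castSucc)
          (fun p : Fin n × α => a (s p.1) p.2)) ∘ g =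
          Sum.elim (fun z : (∅ : Set M) => (z : M)) (fun p => a' (s p.1) p.2) := by
        intro s
        funext z
        rcases z with z | ⟨i, x | j⟩
        · exact z.2.elim
        · rfl
        · rfl
      rw [hg s, hg t] at h
      exact h
    obtain ⟨N, f, hf, hN, hG⟩ := finitelyGood_goodOn hT M ha' (fun _ => c (Fin.last m))
    refine ⟨N, f, hf, hN, fun k n φ s t hs ht hs' ht' => ?_⟩
    -- The old entries of `c` are read off the first term of the tuple, so at least one term is
    -- needed; the empty tuple is trivial.
    rcases n with _ | n
    · rw [Subsingleton.elim s t]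
    choose s' hs1 hs2 using hs'
    choose t' ht1 ht2 using ht'
    let g : Fin (m + 1) ⊕ (Fin (n + 1) × α) →
        Fin 1 ⊕ (Fin (n + 1) × (α ⊕ ULift.{u} (Fin m))) :=
      Sum.elim (Fin.lastCases (Sum.inl 0) (fun j => Sum.inr (0, Sum.inr ⟨j⟩)))
        (fun p => Sum.inr (p.1, Sum.inl p.2))
    have h := hG k (n + 1) (φ.relabel g) s' t'
      (fun i j hij => Subtype.coe_lt_coe.1 (by simpa only [hs2] using hs hij))
      (fun i j hij => Subtype.coe_lt_coe.1 (by simpa only [ht2] using ht hij)) hs1 ht1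
    simp only [Language.Formula.realize_relabel] at h
    have hg : ∀ s : Fin (n + 1) → J, (Sum.elim (fun _ : Fin 1 => c (Fin.last m))
        (fun p : Fin (n + 1) × (α ⊕ ULift.{u} (Fin m)) => a' (s p.1) p.2)) ∘ g =
        Sum.elim c (fun p => a (s p.1) p.2) := by
      intro s
      funext z
      rcases z with j | p
      · induction j using Fin.lastCases with
        | last => simp [g]
        | cast j => simp [g, a']
      · rfl
    rw [hg s', hg t'] at h
    simpa only [hs2, ht2] using h

theorem cutIndiscernible_of_not_ictPattern {T : L.Theory} (hT : ¬ IctPattern T 1) (α : Type u) :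
    CutIndiscernible T α (anySeq L α) finiteSets := by
  intro M I _ _ a ha _ C hC
  have : Finite C := hC
  obtain ⟨m, ⟨e⟩⟩ := Finite.exists_equiv_fin C
  obtain ⟨N, f, hf, hN, hG⟩ := finitelyGood_goodOn_tuple hT M ha m (fun j => e.symm j)
  have hf' : Monotone f := monotoneOn_univ.1 hf
  refine ⟨Setoid.ker f, ⟨fun s => ⟨fun x hx y hy z hz => ?_⟩, ?_⟩, fun r n s t => ?_⟩
  · have hx' : f s = f x := hx
    have hy' : f s = f y := hy
    exact le_antisymm (hx'.trans_le (hf' hz.1)) ((hf' hz.2).trans_eq hy'.symm)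
  · exact Finite.of_injective (fun q : Quotient (Setoid.ker f) => (⟨Setoid.kerLift f q,
      Quotient.inductionOn q fun t => hN t (Set.mem_univ _)⟩ : Fin N))
      (fun q q' h => Setoid.kerLift_injective f (congrArg Fin.val h))
  · ext φ
    let g : C ⊕ (Fin n × α) → Fin m ⊕ (Fin n × α) := Sum.map e id
    have h := hG (f r) n (φ.relabel g) (fun i => s i) (fun i => t i)
      (fun i j hij => s.strictMono hij) (fun i j hij => t.strictMono hij)
      (fun i => ⟨Set.mem_univ _, (s i).2.symm⟩) (fun i => ⟨Set.mem_univ _, (t i).2.symm⟩)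
    simp only [Language.Formula.realize_relabel] at h
    have hg : ∀ w : Fin n × α → M, (Sum.elim (fun j => (e.symm j : M)) w) ∘ g =
        Sum.elim (fun z : C => (z : M)) w := by
      intro w
      funext z
      rcases z with z | p <;> simp [g]
    rw [hg, hg] at h
    exact h

/-! ### The equivalences -/

/-- `ℵ₀` is the smallest candidate in the infimum, and a finite value of `kappaIct` is attained. -/
theorem stronglyDependent_iff {T : L.Theory} :
    StronglyDependent T ↔ ¬ HasIctWitness T (ℵ₀ : Cardinal.{u}) := by
  constructor
  · intro h
    have hmem : kappaIct T ∈ ((fun κ : Cardinal.{u} => (κ : WithTop Cardinal.{u})) ''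
        {κ | ℵ₀ ≤ κ ∧ ¬ HasIctWitness T κ}) := by
      refine csInf_mem (Set.nonempty_iff_ne_empty.2 fun hempty => ?_)
      rw [StronglyDependent, kappaIct, hempty, WithTop.sInf_empty] at h
      exact WithTop.coe_ne_top h.symm
    obtain ⟨κ, hκ, hκ'⟩ := hmem
    have : κ = ℵ₀ := WithTop.coe_injective (hκ'.trans h)
    exact this ▸ hκ.2
  · intro h
    refine IsLeast.csInf_eq ⟨⟨ℵ₀, ⟨le_rfl, h⟩, rfl⟩, ?_⟩
    rintro _ ⟨κ, hκ, rfl⟩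
    exact WithTop.coe_le_coe.2 hκ.1

theorem IndiscernibleOver.comp {M : Type u} [L.Structure M] {C : Set M} {I K α : Type u}
    [LinearOrder I] [LinearOrder K] {a : K → α → M} (h : IndiscernibleOver L C a) (f : I ↪o K) :
    IndiscernibleOver L C (fun t => a (f t)) :=
  fun n s t => h n (s.trans f) (t.trans f)

/-! ### Patterns refute the cutting conditions -/

theorem false_of_separated_types {M : Type u} [L.Structure M] {I α ι : Type u} [Infinite I] {m : ℕ}
    {a : I → α → M} {c : Fin m → M} {ψ : ι → L.Formula (Fin m ⊕ α)} (e : ι ≃ I)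
    (h : ∀ i t, (ψ i).Realize (Sum.elim c (a t)) ↔ e i = t) {E : Setoid I} (hE : Finite (Quotient E))
    (htp : ∀ s t, E.r s t → tp L (Set.range c) (a s) = tp L (Set.range c) (a t)) : False := by
  -- The formula attached to `s` holds of `a s` and of no other term, so `E` is equality, with
  -- infinitely many classes.
  have htriv : ∀ s t, E.r s t → s = t := by
    intro s t hst
    have key : ∀ t, (ψ (e.symm s)).relabel (Sum.map (Set.rangeFactorization c) id) ∈
        tp L (Set.range c) (a t) ↔ s = t := by
      intro t
      change Language.Formula.Realize _ _ ↔ _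
      have h2 := h (e.symm s) t
      rw [e.apply_symm_apply] at h2
      rw [Language.Formula.realize_relabel]
      refine Iff.trans (iff_of_eq (congrArg _ ?_)) h2
      funext z; cases z <;> rfl
    have := (key s).2 rfl
    rw [htp s t hst] at this
    exact (key t).1 this
  exact not_finite_iff_infinite.2 (Infinite.of_injective (Quotient.mk E) fun s t hst =>
    htriv s t (Quotient.exact hst)) hE

/-- The index set is `ω`, so the refutation also covers well-orders; for `η` take a bijection from
the formulas onto `ω`. -/
theorem IctPattern.not_cutTypes {T : L.Theory} {m : ℕ} (h : IctPattern T m) (α : Type u)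
    [Infinite α] {Q : SetClass.{u}} (hQ : ∀ (M : Type u) (c : Fin m → M), Q M (Set.range c)) :
    ¬ CutTypes T α (anySeq L α).wellOrdered Q := by
  intro hcut
  obtain ⟨ι, ψ, hι, hpat⟩ := h.exists_infinite α
  obtain ⟨M, a, c, hψ, -, ha⟩ := hpat (ULift.{u} ℕ)
  obtain ⟨e⟩ := Cardinal.eq.1 (hι.trans (by simp) : #ι = #(ULift.{u} ℕ))
  obtain ⟨E, hE, htp⟩ := hcut M (ULift.{u} ℕ) a ha ⟨inferInstance, trivial⟩ _ (hQ M (c e))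
  exact false_of_separated_types e (fun i t => hψ e i t) hE.2 htp

theorem IctPattern.not_cutTypes_saturated {T : L.Theory} {m : ℕ} (h : IctPattern T m) (α : Type u)
    [Infinite α] {θ : Cardinal.{u}} (hθ : max (ℵ₀ : Cardinal.{u}) L.card < θ)
    (hαθ : #α ^< θ = #α) {Q : SetClass.{u}}
    (hQ : ∀ (M : Type u) (c : Fin m → M), Q M (Set.range c)) :
    ¬ CutTypes T α (satFamilySeq L α θ).wellOrdered Q := by
  intro hcut
  obtain ⟨ι, ψ, p, hι, hpat, hsat⟩ := h.exists_saturated α hθ hαθ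
  have hθ' : ℵ₀ ≤ θ := (le_max_left _ _).trans hθ.le
  -- The successor `θ⁺` is regular even if `θ` is not, so sets of size at most `θ` are bounded in
  -- `J`.
  let J : Type u := (Order.succ θ).ord.ToType
  let I : Type u := ULift.{u} ℕ
  obtain ⟨M, n, c, hψ, hp, hn⟩ := hpat (J ⊕ₗ (Padded I ⊕ₗ Jᵒᵈ))
  obtain ⟨e⟩ := Cardinal.eq.1 (hι.trans (by simp [I]) : #ι = #I)
  let f : I ↪o (J ⊕ₗ (Padded I ⊕ₗ Jᵒᵈ)) := (midEmb _ I _).trans (midEmb J (Padded I) Jᵒᵈ)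
  have hfam := inSaturatedFamily_of_indiscernible hθ' (fun hX => exists_forall_lt_of_mk_le hθ' hX)
    hn fun t => hsat M _ (hp t)
  obtain ⟨E, hE, htp⟩ := hcut M I (fun t => n (f t)) (hn.comp f) ⟨inferInstance, hfam⟩ _
    (hQ M (c fun i => f (e i)))
  -- The function `η = f ∘ e` takes its values in the middle copy of `I`, so one tuple already
  -- separates all terms there.
  exact false_of_separated_types e (fun i t => (hψ _ i (f t)).trans f.injective.eq_iff) hE.2 htp

theorem CutIndiscernible.cutTypes {T : L.Theory} {α : Type u} {P : SeqClass L α} {Q : SetClass.{u}}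
    (h : CutIndiscernible T α P Q) : CutTypes T α P Q := by
  intro M I _ _ a ha hP C hC
  obtain ⟨E, hE, hind⟩ := h M I a ha hP C hC
  refine ⟨E, hE, fun s t hst => ?_⟩
  ext φ
  let pt : {t // E.r s t} → Fin 1 ↪o {t // E.r s t} := fun x =>
    OrderEmbedding.ofStrictMono (fun _ => x) (fun i j hij => by
      rw [Subsingleton.elim i j] at hij; exact (lt_irrefl _ hij).elim)
  have h1 := hind s 1 (pt ⟨s, E.refl s⟩) (pt ⟨t, hst⟩)
  have key : ∀ w : Fin 1 × α → M, φ.relabel (Sum.map id fun x => ((0 : Fin 1), x)) ∈ tp L C w ↔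
      φ ∈ tp L C (fun x => w (0, x)) := fun w => realize_sum_relabel φ _ _ _
  exact (key _).symm.trans ((Set.ext_iff.1 h1 _).trans (key _))

theorem CutTypes.mono {T : L.Theory} {α : Type u} {P P' : SeqClass L α} {Q Q' : SetClass.{u}}
    (h : CutTypes T α P Q)
    (hP : ∀ (M : Type u) [L.Structure M] (I : Type u) [LinearOrder I] (a : I → α → M),
      P' M I a → P M I a) (hQ : ∀ M C, Q' M C → Q M C) : CutTypes T α P' Q' :=
  fun M I _ _ a ha ha' C hC => h M I a ha (hP M I a ha') C (hQ M C hC)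

theorem CutIndiscernible.mono {T : L.Theory} {α : Type u} {P P' : SeqClass L α}
    {Q Q' : SetClass.{u}} (h : CutIndiscernible T α P Q)
    (hP : ∀ (M : Type u) [L.Structure M] (I : Type u) [LinearOrder I] (a : I → α → M),
      P' M I a → P M I a) (hQ : ∀ M C, Q' M C → Q M C) : CutIndiscernible T α P' Q' :=
  fun M I _ _ a ha ha' C hC => h M I a ha (hP M I a ha') C (hQ M C hC)

theorem finiteSets_of_singletons (M : Type u) (C : Set M) (h : singletons M C) :
    finiteSets M C := by
  obtain ⟨c, rfl⟩ := h
  exact Set.finite_singleton c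

theorem singletons_range (M : Type u) (c : Fin 1 → M) : singletons M (Set.range c) :=
  ⟨c 0, by rw [Set.range_unique]; rfl⟩

theorem StronglyDependent.not_ictPattern {T : L.Theory} (h : StronglyDependent T) (m : ℕ) :
    ¬ IctPattern T m :=
  fun hm => stronglyDependent_iff.1 h (hasIctWitness_aleph0_iff.2 ⟨m, hm⟩)

/-- Patterns in one variable suffice to refute strong dependence. -/
theorem stronglyDependent_of_not_ictPattern {T : L.Theory} (h : ¬ IctPattern T 1) :
    StronglyDependent T := by
  rw [stronglyDependent_iff, hasIctWitness_aleph0_iff]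
  rintro ⟨m, hm⟩
  -- A pattern in `m` variables would refute the cutting condition for the finite set of entries of
  -- an `m`-tuple, which holds in the absence of one-variable patterns. Any infinite tuple length
  -- would do.
  refine hm.not_cutTypes (ULift.{u} ℕ) (Q := finiteSets) (fun M c => Set.finite_range c) ?_
  exact (cutIndiscernible_of_not_ictPattern h _).cutTypes.mono
    (fun _ _ _ _ _ _ => trivial) (fun _ _ h => h)

/-- The four conditions for a class `P` of sequences are equivalent to strong dependence if `P`
contains a class in which patterns can be found. -/
theorem stronglyDependent_tfae {T : L.Theory} {α : Type u} (P P' : SeqClass L α)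
    (hP : ∀ (M : Type u) [L.Structure M] (I : Type u) [LinearOrder I] (a : I → α → M),
      P' M I a → P M I a)
    (hP' : CutTypes T α P' singletons → ¬ IctPattern T 1) :
    List.TFAE [StronglyDependent T, CutTypes T α P finiteSets, CutIndiscernible T α P finiteSets,
      CutTypes T α P singletons, CutIndiscernible T α P singletons] := by
  tfae_have 1 → 3 := fun h => (cutIndiscernible_of_not_ictPattern (h.not_ictPattern 1) α).mono
    (fun _ _ _ _ _ _ => trivial) (fun _ _ h => h)
  tfae_have 3 → 5 := fun h => h.mono (fun _ _ _ _ _ h => h) finiteSets_of_singletons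
  tfae_have 3 → 2 := CutIndiscernible.cutTypes
  tfae_have 5 → 4 := CutIndiscernible.cutTypes
  tfae_have 2 → 4 := fun h => h.mono (fun _ _ _ _ _ h => h) finiteSets_of_singletons
  tfae_have 4 → 1 := fun h => stronglyDependent_of_not_ictPattern
    (hP' (h.mono hP (fun _ _ h => h)))
  tfae_finish

end StrongDep

theorem mainTheorem4 (L : FirstOrder.Language.{u, u}) (T : L.Theory) (hT : T.IsComplete)
    (α : Type u) [Infinite α] :
    List.TFAE [
      StrongDep.StronglyDependent T,
      StrongDep.CutTypes T α (StrongDep.anySeq L α) StrongDep.finiteSets,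
      StrongDep.CutIndiscernible T α (StrongDep.anySeq L α) StrongDep.finiteSets,
      StrongDep.CutTypes T α (StrongDep.anySeq L α) StrongDep.singletons,
      StrongDep.CutIndiscernible T α (StrongDep.anySeq L α) StrongDep.singletons,
      StrongDep.CutTypes T α (StrongDep.anySeq L α).wellOrdered StrongDep.finiteSets,
      StrongDep.CutIndiscernible T α (StrongDep.anySeq L α).wellOrdered StrongDep.finiteSets,
      StrongDep.CutTypes T α (StrongDep.anySeq L α).wellOrdered StrongDep.singletons,
      StrongDep.CutIndiscernible T α (StrongDep.anySeq L α).wellOrdered StrongDep.singletons] ∧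
    ∀ θ : Cardinal.{u}, max (ℵ₀ : Cardinal.{u}) L.card < θ → (#α) ^< θ = #α →
      ∀ P ∈ ({StrongDep.satSeq L α θ, (StrongDep.satSeq L α θ).wellOrdered,
          StrongDep.satFamilySeq L α θ, (StrongDep.satFamilySeq L α θ).wellOrdered} :
          Set (StrongDep.SeqClass L α)),
        List.TFAE [
          StrongDep.StronglyDependent T,
          StrongDep.CutTypes T α P StrongDep.finiteSets,
          StrongDep.CutIndiscernible T α P StrongDep.finiteSets,
          StrongDep.CutTypes T α P StrongDep.singletons,
          StrongDep.CutIndiscernible T α P StrongDep.singletons] := by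
  constructor
  · have hwo : StrongDep.CutTypes T α (StrongDep.anySeq L α).wellOrdered StrongDep.singletons →
        ¬ StrongDep.IctPattern T 1 := fun h h' =>
      h'.not_cutTypes α StrongDep.singletons_range h
    have h1 := StrongDep.stronglyDependent_tfae (StrongDep.anySeq L α)
      (StrongDep.anySeq L α).wellOrdered (fun _ _ _ _ _ h => h.2) hwo
    have h2 := StrongDep.stronglyDependent_tfae (StrongDep.anySeq L α).wellOrdered
      (StrongDep.anySeq L α).wellOrdered (fun _ _ _ _ _ h => h) hwo
    tfae_have 1 ↔ 2 := h1.out 0 1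
    tfae_have 1 ↔ 3 := h1.out 0 2
    tfae_have 1 ↔ 4 := h1.out 0 3
    tfae_have 1 ↔ 5 := h1.out 0 4
    tfae_have 1 ↔ 6 := h2.out 0 1
    tfae_have 1 ↔ 7 := h2.out 0 2
    tfae_have 1 ↔ 8 := h2.out 0 3
    tfae_have 1 ↔ 9 := h2.out 0 4
    tfae_finish
  · intro θ hθ hαθ P hP
    -- The most restricted class is contained in each of the four, so a refutation there is enough.
    refine StrongDep.stronglyDependent_tfae P (StrongDep.satFamilySeq L α θ).wellOrdered ?_
      fun h h' => h'.not_cutTypes_saturated α hθ hαθ StrongDep.singletons_range h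
    have hsat : ∀ (M : Type u) [L.Structure M] (I : Type u) [LinearOrder I] (a : I → α → M),
        StrongDep.satFamilySeq L α θ M I a → StrongDep.satSeq L α θ M I a := by
      rintro M _ I _ a ⟨_, _, _, _, h, _⟩
      exact h
    rcases hP with rfl | rfl | rfl | rfl
    · exact fun M _ I _ a h => hsat M I a h.2
    · exact fun M _ I _ a h => ⟨h.1, hsat M I a h.2⟩
    · exact fun M _ I _ a h => h.2
    · exact fun M _ I _ a h => h
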